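/- Let $\mathbf K$ be a field of characteristic $0$. Let $\mathrm{QSym}$ be the algebra of quasisymmetric functions in $x_1,x_2,\dots$ over $\mathbf K$, with monomial basis $M_\alpha=\sum_{j_1<\cdots<j_k}x_{j_1}^{\alpha_1}\cdots x_{j_k}^{\alpha_k}$ and fundamental basis $F_\alpha$ (the sum of $M_\beta$ over all refinements $\beta$ of $\alpha$); here $\alpha=(\alpha_1,\dots,\alpha_k)$ runs over compositions, that is, finite sequences of positive integers. Let $\mathrm{NSym}=\mathbf K\langle H_1,H_2,\dots\rangle$, with $H_0=1$, $H_m=0$ for $m<0$, $H_\alpha=H_{\alpha_1}\cdots H_{\alpha_k}$, and the pairing with $\mathrm{QSym}$ given by $\langle H_\alpha,M_\beta\rangle=\delta_{\alpha\beta}$. The immaculate functions are $\mathfrak S_\mu=\mathbb B_{\mu_1}\cdots\mathbb B_{\mu_k}(1)$, where $\mathbb B_m=\sum_{i\ge 0}(-1)^iH_{m+i}F_{1^i}^{\perp}$ and $F_{1^i}^\perp$ is adjoint to multiplication by $F_{1^i}$. The dual immaculate functions $\mathfrak S^*_\beta\in\mathrm{QSym}$ are defined by $\langle\mathfrak S_\mu,\mathfrak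 S^*_\beta\rangle=\delta_{\mu\beta}$ for all compositions $\mu,\beta$. Tunnel hook coverings. Let $\mu\in\mathbb Z^k$. Put $\nu^{(0)}=(0,\dots,0)$ and, for $r=1,\dots,k$, do the following with $\nu=\nu^{(r-1)}$. For each row $i$ let $b_i=\mu_i-\nu_i$, $c_i=0$ if $\mu_i>0$ and $\nu_i\le\mu_i$; let $b_i=0$, $c_i=\nu_i-\mu_i$ if $0<\mu_i<\nu_i$; let $b_i=0$, $c_i=|\mu_i|+\nu_i$ if $\mu_i\le 0$. The boundary cells are the cells (row, column) $=(p,q)$ with $r<p\le k$ and $\nu_p+1\le q\le\nu_{p-1}+1$, together with the cells $(r,q)$ with $\nu_r+1\le q\le\max\{\nu_r+1,\ \nu_r+b_r+c_r\}$. A tunnel cell is a boundary cell $(p,q)$ with $q=\nu_p+1$. Choose a tunnel cell $\tau_r=(p,q)$. The tunnel hook $\mathfrak h(r,\tau_r)$ is the set of all boundary cells in the rows $r,\dots,p$; its sign is $\epsilon(\mathfrak h(r,\tau_r))=(-1)^{p-r}$ and its value is $\Delta(\mathfrak h(r,\tau_r))=(b_r-c_r)+(\nu_r+1-q)+(p-r)$.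 Let $\nu^{(r)}_i$ be $\nu^{(r-1)}_i$ plus the number of cells of $\mathfrak h(r,\tau_r)$ in row $i$. Every sequence of choices gives a tunnel hook covering $\gamma=\{\mathfrak h(1,\tau_1),\dots,\mathfrak h(k,\tau_k)\}$ of $\mu$, with $\Delta(\gamma)=(\Delta(\mathfrak h(1,\tau_1)),\dots,\Delta(\mathfrak h(k,\tau_k)))$. Let $\mathrm{THC}_\mu$ be the set of all of them. For a sequence $a$ of integers let $\mathrm{fl}(a)$ be the sequence obtained by deleting all zeros from $a$ (negative entries are kept). Theorem. For every composition $\alpha$, $$M_\alpha=\sum_{\mu\models|\alpha|}\ \ \sum_{\substack{\gamma\in\mathrm{THC}_\mu\\ \mathrm{fl}(\Delta(\gamma))=\alpha}}\Bigl(\prod_{r=1}^{\ell(\mu)}\epsilon(\mathfrak h(r,\tau_r))\Bigr)\,\mathfrak S^*_\mu ,$$ where $\mu$ runs over the compositions of $|\alpha|$ and $\ell(\mu)$ is the number of parts of $\mu$. -/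

import Mathlib

noncomputable section

namespace QSymNSym

/-! ### Quasisymmetric functions -/

/-- The exponent vector of `x₁^{a₁} x₂^{a₂} ⋯ x_k^{a_k}`; the variables are indexed by `ℕ`, so
that `x₁, x₂, …` are the variables number `0, 1, …`. -/
def expo (l : List ℕ) : ℕ →₀ ℕ :=
  ∑ i : Fin l.length, Finsupp.single (i : ℕ) (l.get i)

theorem expo_ofFn {k : ℕ} (a : Fin k → ℕ) :
    expo (List.ofFn a) = ∑ i : Fin k, Finsupp.single (i : ℕ) (a i) :=
  Fintype.sum_equiv (finCongr List.length_ofFn) _ _ fun i => by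
    simp; rfl

section QSymDef

variable (K : Type*) [CommRing K]

/-- The coefficient of `x_{j₁}^{α₁} ⋯ x_{j_k}^{α_k}` equals that of `x₁^{α₁} ⋯ x_k^{α_k}` for every
composition `α` and all `j₁ < ⋯ < j_k`. -/
def IsQuasisymmetric {K : Type*} [CommRing K] (f : MvPowerSeries ℕ K) : Prop :=
  ∀ (k : ℕ) (α : Fin k → ℕ) (j : Fin k → ℕ), (∀ i, 0 < α i) → StrictMono j →
    MvPowerSeries.coeff (∑ i, Finsupp.single (j i) (α i)) f =
      MvPowerSeries.coeff (∑ i : Fin k, Finsupp.single (i : ℕ) (α i)) f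

def HasBoundedDegree {K : Type*} [CommRing K] (f : MvPowerSeries ℕ K) : Prop :=
  ∃ N : ℕ, ∀ d : ℕ →₀ ℕ, MvPowerSeries.coeff d f ≠ 0 → d.degree ≤ N

variable {K}

theorem exists_strictMono_extend {k : ℕ} {j : Fin k → ℕ} (hj : StrictMono j) :
    ∃ e : ℕ → ℕ, StrictMono e ∧ ∀ i : Fin k, e i = j i := by
  refine ⟨fun n => if h : n < k then j ⟨n, h⟩ else n + (∑ i, j i) + 1, ?_, fun i => by simp⟩
  intro a b hab
  by_cases hb : b < k
  · have ha : a < k := hab.trans hb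
    simpa [ha, hb] using hj (show (⟨a, ha⟩ : Fin k) < ⟨b, hb⟩ from hab)
  · by_cases ha : a < k
    · have := Finset.single_le_sum (f := j) (fun i _ => Nat.zero_le _) (Finset.mem_univ ⟨a, ha⟩)
      simp only [ha, hb, dite_true, dite_false]
      omega
    · simp only [ha, hb, dite_false]
      omega

theorem exists_eq_sum_single (d : ℕ →₀ ℕ) :
    ∃ (k : ℕ) (α : Fin k → ℕ) (j : Fin k → ℕ), (∀ i, 0 < α i) ∧ StrictMono j ∧
      d = ∑ i, Finsupp.single (j i) (α i) := by
  refine ⟨d.support.card, fun i => d (d.support.orderEmbOfFin rfl i),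
    d.support.orderEmbOfFin rfl, fun i => ?_, (d.support.orderEmbOfFin rfl).strictMono, ?_⟩
  · have := d.support.orderEmbOfFin_mem rfl i
    exact Nat.pos_of_ne_zero (Finsupp.mem_support_iff.1 this)
  · conv_lhs => rw [← Finsupp.sum_single d, Finsupp.sum]
    conv_lhs => rw [← Finset.map_orderEmbOfFin_univ d.support rfl]
    rw [Finset.sum_map]
    rfl

theorem isQuasisymmetric_iff (f : MvPowerSeries ℕ K) :
    IsQuasisymmetric f ↔ ∀ e : ℕ → ℕ, StrictMono e → ∀ d : ℕ →₀ ℕ,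
      MvPowerSeries.coeff (d.mapDomain e) f = MvPowerSeries.coeff d f := by
  constructor
  · intro h e he d
    obtain ⟨k, α, j, hα, hj, rfl⟩ := exists_eq_sum_single d
    rw [h k α j hα hj, Finsupp.mapDomain_finsetSum]
    simp only [Finsupp.mapDomain_single]
    exact h k α (fun i => e (j i)) hα (he.comp hj)
  · intro h k α j _ hj
    obtain ⟨e, he, hej⟩ := exists_strictMono_extend hj
    rw [← h e he (∑ i : Fin k, Finsupp.single (i : ℕ) (α i)), Finsupp.mapDomain_finsetSum]
    simp only [Finsupp.mapDomain_single, hej]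

theorem IsQuasisymmetric.mul {f g : MvPowerSeries ℕ K} (hf : IsQuasisymmetric f)
    (hg : IsQuasisymmetric g) : IsQuasisymmetric (f * g) := by
  classical
  rw [isQuasisymmetric_iff] at *
  intro e he d
  rw [MvPowerSeries.coeff_mul, MvPowerSeries.coeff_mul]
  symm
  refine Finset.sum_bij (fun p _ => (p.1.mapDomain e, p.2.mapDomain e)) ?_ ?_ ?_ ?_
  · rintro ⟨a, b⟩ hab
    rw [Finset.HasAntidiagonal.mem_antidiagonal] at hab ⊢
    simp only at hab ⊢
    rw [← Finsupp.mapDomain_add, hab]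
  · rintro ⟨a, b⟩ _ ⟨a', b'⟩ _ hp
    have h1 : a = a' := Finsupp.mapDomain_injective he.injective (Prod.mk.inj hp).1
    have h2 : b = b' := Finsupp.mapDomain_injective he.injective (Prod.mk.inj hp).2
    rw [h1, h2]
  · rintro ⟨a, b⟩ hab
    rw [Finset.HasAntidiagonal.mem_antidiagonal] at hab
    simp only at hab
    have hsub : ∀ c c' : ℕ →₀ ℕ, c + c' = d.mapDomain e → ∃ c₀ : ℕ →₀ ℕ, c₀.mapDomain e = c := by
      intro c c' hc
      refine ⟨c.comapDomain e he.injective.injOn, Finsupp.mapDomain_comapDomain e he.injective c ?_⟩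
      intro x hx
      by_contra hxe
      have h0 := DFunLike.congr_fun hc x
      rw [Finsupp.mapDomain_of_notMem_range _ _ hxe, Finsupp.add_apply] at h0
      have : c x ≠ 0 := by simpa using hx
      omega
    obtain ⟨a₀, rfl⟩ := hsub a b hab
    obtain ⟨b₀, rfl⟩ := hsub b _ ((add_comm _ _).trans hab)
    refine ⟨(a₀, b₀), ?_, rfl⟩
    rw [Finset.HasAntidiagonal.mem_antidiagonal]
    rw [← Finsupp.mapDomain_add] at hab
    exact Finsupp.mapDomain_injective he.injective hab
  · rintro ⟨a, b⟩ _
    simp only [hf e he, hg e he]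

theorem HasBoundedDegree.mul {f g : MvPowerSeries ℕ K} (hf : HasBoundedDegree f)
    (hg : HasBoundedDegree g) : HasBoundedDegree (f * g) := by
  classical
  obtain ⟨N, hN⟩ := hf
  obtain ⟨M, hM⟩ := hg
  refine ⟨N + M, fun d hd => ?_⟩
  rw [MvPowerSeries.coeff_mul] at hd
  obtain ⟨⟨a, b⟩, hab, hne⟩ := Finset.exists_ne_zero_of_sum_ne_zero hd
  rw [Finset.HasAntidiagonal.mem_antidiagonal] at hab
  simp only at hab hne
  rw [← hab, map_add]
  exact Nat.add_le_add (hN a (left_ne_zero_of_mul hne)) (hM b (right_ne_zero_of_mul hne))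

variable (K) in
/-- The algebra of quasisymmetric functions. -/
def QSym : Subalgebra K (MvPowerSeries ℕ K) where
  carrier := {f | IsQuasisymmetric f ∧ HasBoundedDegree f}
  mul_mem' hf hg := ⟨hf.1.mul hg.1, hf.2.mul hg.2⟩
  add_mem' := by
    rintro f g ⟨hf, N, hN⟩ ⟨hg, M, hM⟩
    refine ⟨fun k α j hα hj => ?_, N + M, fun d hd => ?_⟩
    · rw [map_add, map_add, hf k α j hα hj, hg k α j hα hj]
    · rw [map_add] at hd
      by_cases h : MvPowerSeries.coeff d f = 0
      · rw [h, zero_add] at hd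
        exact (hM d hd).trans (Nat.le_add_left _ _)
      · exact (hN d h).trans (Nat.le_add_right _ _)
  algebraMap_mem' r := by
    classical
    refine ⟨?_, 0, fun d hd => ?_⟩
    · rw [isQuasisymmetric_iff]
      intro e he d
      have hz : d.mapDomain e = 0 ↔ d = 0 := by
        constructor
        · intro h
          exact Finsupp.mapDomain_injective he.injective (by rw [h, Finsupp.mapDomain_zero])
        · rintro rfl
          exact Finsupp.mapDomain_zero
      simp only [MvPowerSeries.algebraMap_apply, MvPowerSeries.coeff_C, hz]
    · simp only [MvPowerSeries.algebraMap_apply, MvPowerSeries.coeff_C] at hd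
      have : d = 0 := by
        by_contra h
        simp [h] at hd
      simp [this]

open Classical in
/-- The formal sum of all `x_{j₁}^{α₁} ⋯ x_{j_k}^{α_k}` with `j₁ < ⋯ < j_k`. As the parts of `α` are
positive, distinct `j` give distinct monomials, so all coefficients are `0` or `1`. -/
def monomialSeries (K : Type*) [CommRing K] {n : ℕ} (α : Composition n) : MvPowerSeries ℕ K :=
  fun d => if ∃ j : Fin α.length → ℕ, StrictMono j ∧
    d = ∑ i, Finsupp.single (j i) (α.blocksFun i) then 1 else 0

open Classical in
theorem coeff_monomialSeries {n : ℕ} (α : Composition n) (d : ℕ →₀ ℕ) :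
    MvPowerSeries.coeff d (monomialSeries K α) = if ∃ j : Fin α.length → ℕ, StrictMono j ∧
      d = ∑ i, Finsupp.single (j i) (α.blocksFun i) then 1 else 0 := rfl

theorem degree_of_coeff_monomialSeries_ne_zero {n : ℕ} (α : Composition n) (d : ℕ →₀ ℕ)
    (h : MvPowerSeries.coeff d (monomialSeries K α) ≠ 0) : d.degree = n := by
  classical
  rw [coeff_monomialSeries] at h
  obtain ⟨j, -, rfl⟩ : ∃ j : Fin α.length → ℕ, StrictMono j ∧
      d = ∑ i, Finsupp.single (j i) (α.blocksFun i) := by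
    by_contra hc
    exact h (if_neg hc)
  simp only [map_sum, Finsupp.degree_single]
  exact α.sum_blocksFun

theorem monomialSeries_mem {n : ℕ} (α : Composition n) : monomialSeries K α ∈ QSym K := by
  classical
  refine ⟨?_, n, fun d hd => (degree_of_coeff_monomialSeries_ne_zero α d hd).le⟩
  rw [isQuasisymmetric_iff]
  intro e he d
  rw [coeff_monomialSeries, coeff_monomialSeries]
  congr 1
  refine propext ⟨?_, ?_⟩
  · rintro ⟨j, hj, hd⟩
    have hr : ∀ i, ∃ m, e m = j i := by
      intro i
      by_contra hc
      have h0 := DFunLike.congr_fun hd (j i)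
      rw [Finsupp.mapDomain_of_notMem_range _ _ hc, Finsupp.finsetSum_apply] at h0
      have h1 := Finset.single_le_sum
        (f := fun i' => (Finsupp.single (j i') (α.blocksFun i')) (j i))
        (fun _ _ => Nat.zero_le _) (Finset.mem_univ i)
      have h2 := α.one_le_blocksFun i
      simp only [Finsupp.single_eq_same] at h1
      omega
    choose j₀ hj₀ using hr
    refine ⟨j₀, fun a b hab => ?_, ?_⟩
    · have := hj hab
      rw [← hj₀, ← hj₀] at this
      exact he.lt_iff_lt.1 this
    · apply Finsupp.mapDomain_injective he.injective
      rw [hd, Finsupp.mapDomain_finsetSum]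
      simp only [Finsupp.mapDomain_single, hj₀]
  · rintro ⟨j, hj, rfl⟩
    refine ⟨fun i => e (j i), he.comp hj, ?_⟩
    rw [Finsupp.mapDomain_finsetSum]
    simp only [Finsupp.mapDomain_single]

/-- The monomial quasisymmetric function `M_α`. -/
def monomialQSym (K : Type*) [CommRing K] {n : ℕ} (α : Composition n) : QSym K :=
  ⟨monomialSeries K α, monomialSeries_mem α⟩

/-- The fundamental quasisymmetric function `F_α`, the sum of the `M_β` over all compositions `β`
that refine `α`. -/
def fundamentalQSym (K : Type*) [CommRing K] {n : ℕ} (α : Composition n) : QSym K :=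
  ∑ β : Composition n with α.boundaries ⊆ β.boundaries, monomialQSym K β

/-- Distinct compositions give distinct leading monomials. -/
theorem coeff_expo_monomialSeries {m n : ℕ} (α : Composition m) (β : Composition n) :
    MvPowerSeries.coeff (expo α.blocks) (monomialSeries K β) =
      if α.blocks = β.blocks then 1 else 0 := by
  classical
  rw [coeff_monomialSeries]
  congr 1
  refine propext ⟨?_, ?_⟩
  · rintro ⟨j, hj, hd⟩
    have happ : ∀ (k : ℕ) (a u : Fin k → ℕ) (_ : StrictMono u) (i : Fin k),
        (∑ i, Finsupp.single (u i) (a i)) (u i) = a i := by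
      intro k a u hu i
      rw [Finsupp.finsetSum_apply, Finset.sum_eq_single i]
      · simp
      · intro b _ hb
        exact Finsupp.single_eq_of_ne (fun h => hb (hu.injective h).symm)
      · simp
    have hout : ∀ (k : ℕ) (a u : Fin k → ℕ) (x : ℕ), x ∉ Set.range u →
        (∑ i, Finsupp.single (u i) (a i)) x = 0 := by
      intro k a u x hx
      rw [Finsupp.finsetSum_apply]
      refine Finset.sum_eq_zero fun i _ => ?_
      exact Finsupp.single_eq_of_ne (fun h => hx ⟨i, h.symm⟩)
    have hval : StrictMono (fun i : Fin α.blocks.length => (i : ℕ)) := fun _ _ h => h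
    have hrange : Set.range j = Set.range (fun i : Fin α.blocks.length => (i : ℕ)) := by
      ext x
      constructor
      · rintro ⟨i, rfl⟩
        by_contra hc
        have h1 := happ _ β.blocksFun j hj i
        rw [← hd] at h1
        have h2 := hout _ α.blocks.get (fun i => (i : ℕ)) (j i) hc
        have h3 := β.one_le_blocksFun i
        rw [expo] at h1
        omega
      · rintro ⟨i, rfl⟩
        by_contra hc
        have h1 := happ _ α.blocks.get _ hval i
        have h2 := hout _ β.blocksFun j (i : ℕ) hc
        rw [← hd, expo] at h2
        have h3 := α.one_le_blocksFun i
        have h4 : α.blocks.get i = α.blocksFun i := rfl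
        omega
    have hlen : β.blocks.length = α.blocks.length := by
      have h1 := Set.ncard_range_of_injective hj.injective
      have h2 := Set.ncard_range_of_injective hval.injective
      rw [hrange, h2] at h1
      simpa using h1.symm
    have hji : ∀ i : Fin β.blocks.length, j i = i := by
      intro i
      have h5 : StrictMono (fun i : Fin β.blocks.length => (i : ℕ)) := fun _ _ h => h
      have h6 : Set.range (fun i : Fin β.blocks.length => (i : ℕ)) =
          Set.range (fun i : Fin α.blocks.length => (i : ℕ)) := by rw [hlen]
      have h7 := (StrictMono.range_inj hj h5).1 (hrange.trans h6.symm)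
      exact congrFun h7 i
    refine List.ext_getElem hlen.symm fun i h1 h2 => ?_
    have h3 := happ _ α.blocks.get _ hval ⟨i, h1⟩
    have h4 := happ _ β.blocksFun j hj ⟨i, h2⟩
    rw [← hd, hji] at h4
    rw [expo] at h4
    exact h3.symm.trans h4
  · intro h
    rw [h]
    exact ⟨fun i => i, fun _ _ h => h, rfl⟩

end QSymDef

/-! ### Noncommutative symmetric functions and the pairing with quasisymmetric functions -/

section NSymDef

variable (K : Type*) [CommRing K]

/-- The algebra of noncommutative symmetric functions, the free associative algebra on
`H₁, H₂, …`. -/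
abbrev NSym : Type _ := FreeAlgebra K ℕ+

/-- The generators `H_m`, with `H_0 = 1` and `H_m = 0` for `m < 0`. -/
def H (m : ℤ) : NSym K :=
  if h : 0 < m then FreeAlgebra.ι K ⟨m.toNat, by omega⟩ else if m = 0 then 1 else 0

/-- `H_{(a₁, …, a_k)} = H_{a₁} ⋯ H_{a_k}` for a sequence of integers. -/
def HSeq (a : List ℤ) : NSym K := (a.map (H K)).prod

/-- The basis of `NSym` that consists of the words in `H₁, H₂, …`; a word is the same as a
composition. -/
def wordBasis : Module.Basis (FreeMonoid ℕ+) K (NSym K) := FreeAlgebra.basisFreeMonoid K ℕ+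

def parts (w : FreeMonoid ℕ+) : List ℕ := (FreeMonoid.toList w).map PNat.val

def seq {n : ℕ} (α : Composition n) : List ℤ := α.blocks.map (Nat.cast : ℕ → ℤ)

variable {K}

theorem wordBasis_eq (w : FreeMonoid ℕ+) : wordBasis K w =
    FreeAlgebra.equivMonoidAlgebraFreeMonoid.symm (MonoidAlgebra.of K (FreeMonoid ℕ+) w) := by
  rfl

theorem wordBasis_one : wordBasis K 1 = 1 := by
  rw [wordBasis_eq, map_one, map_one]

theorem wordBasis_mul (v w : FreeMonoid ℕ+) :
    wordBasis K (v * w) = wordBasis K v * wordBasis K w := by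
  rw [wordBasis_eq, wordBasis_eq, wordBasis_eq, map_mul, map_mul]

theorem wordBasis_of (a : ℕ+) : wordBasis K (FreeMonoid.of a) = FreeAlgebra.ι K a := by
  rw [wordBasis_eq, AlgEquiv.symm_apply_eq]
  simp [FreeAlgebra.equivMonoidAlgebraFreeMonoid]

theorem parts_one : parts 1 = [] := rfl

theorem parts_of_mul (a : ℕ+) (w : FreeMonoid ℕ+) :
    parts (FreeMonoid.of a * w) = (a : ℕ) :: parts w := rfl

theorem H_pnat (a : ℕ+) : H K ((a : ℕ) : ℤ) = wordBasis K (FreeMonoid.of a) := by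
  rw [wordBasis_of, H, dif_pos (by exact_mod_cast a.pos)]
  congr 1

/-- The word basis is the basis of the `H_α`. -/
theorem wordBasis_eq_HSeq (w : FreeMonoid ℕ+) :
    wordBasis K w = HSeq K ((parts w).map (Nat.cast : ℕ → ℤ)) := by
  induction w using FreeMonoid.recOn with
  | one => simp [parts_one, HSeq, wordBasis_one]
  | of_mul a w ih =>
    rw [wordBasis_mul, ih, ← H_pnat, parts_of_mul, List.map_cons]
    simp only [HSeq, List.map_cons, List.prod_cons]

theorem exists_word (l : List ℕ) (hl : ∀ a ∈ l, 0 < a) : ∃ w, parts w = l := by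
  induction l with
  | nil => exact ⟨1, rfl⟩
  | cons a l ih =>
    obtain ⟨w, hw⟩ := ih fun b hb => hl b (List.mem_cons_of_mem _ hb)
    obtain ⟨p, rfl⟩ : ∃ p : ℕ+, (p : ℕ) = a := ⟨⟨a, hl a List.mem_cons_self⟩, rfl⟩
    exact ⟨FreeMonoid.of p * w, by rw [parts_of_mul, hw]⟩

theorem parts_pos (w : FreeMonoid ℕ+) : ∀ a ∈ parts w, 0 < a := by
  intro a ha
  obtain ⟨b, -, rfl⟩ := List.mem_map.1 ha
  exact PNat.pos b

theorem parts_injective : Function.Injective parts := fun _ _ h =>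
  FreeMonoid.toList.injective (List.map_injective_iff.2 PNat.coe_injective h)

/-- The composition that belongs to a word. -/
def wordComp (w : FreeMonoid ℕ+) : Composition (parts w).sum where
  blocks := parts w
  blocks_pos := fun h => parts_pos w _ h
  blocks_sum := rfl

theorem exists_word_comp {n : ℕ} (α : Composition n) :
    ∃ w, parts w = α.blocks ∧ (parts w).sum = n ∧ HSeq K (seq α) = wordBasis K w := by
  obtain ⟨w, hw⟩ := exists_word α.blocks fun a ha => α.blocks_pos ha
  exact ⟨w, hw, by rw [hw, α.blocks_sum], by rw [wordBasis_eq_HSeq, hw, seq]⟩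

variable (K) in
/-- The pairing of `NSym` with `QSym`: the value of `⟨H_α, f⟩` is the coefficient of
`x₁^{α₁} ⋯ x_k^{α_k}` in `f`, that is, the coefficient of `M_α` in the expansion of `f`. -/
def pairing : NSym K →ₗ[K] QSym K →ₗ[K] K :=
  (wordBasis K).constr K fun w =>
    (MvPowerSeries.coeff (R := K) (expo (parts w))).comp (QSym K).val.toLinearMap

theorem pairing_wordBasis (w : FreeMonoid ℕ+) (f : QSym K) :
    pairing K (wordBasis K w) f = MvPowerSeries.coeff (expo (parts w)) f.1 := by
  rw [pairing, Module.Basis.constr_basis]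
  rfl

theorem pairing_wordBasis_monomial (w : FreeMonoid ℕ+) {n : ℕ} (β : Composition n) :
    pairing K (wordBasis K w) (monomialQSym K β) = if parts w = β.blocks then 1 else 0 := by
  rw [pairing_wordBasis]
  exact coeff_expo_monomialSeries (wordComp w) β

/-- `⟨H_α, M_β⟩ = δ_{αβ}`. -/
theorem pairing_H_monomial {m n : ℕ} (α : Composition m) (β : Composition n) :
    pairing K (HSeq K (seq α)) (monomialQSym K β) = if α.blocks = β.blocks then 1 else 0 := by
  obtain ⟨w, hw, -, h⟩ := exists_word_comp (K := K) α
  rw [h, pairing_wordBasis_monomial, hw]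

/-- A quasisymmetric function is determined by its pairings with the `H_α`. -/
theorem qsym_ext {f g : QSym K}
    (h : ∀ w, pairing K (wordBasis K w) f = pairing K (wordBasis K w) g) : f = g := by
  apply Subtype.ext
  ext d
  obtain ⟨k, a, j, ha, hj, rfl⟩ := exists_eq_sum_single d
  rw [f.2.1 k a j ha hj, g.2.1 k a j ha hj]
  obtain ⟨w, hw⟩ := exists_word (List.ofFn a) (by
    intro b hb
    obtain ⟨i, rfl⟩ := (List.mem_ofFn' _ _).1 hb
    exact ha i)
  have := h w
  rw [pairing_wordBasis, pairing_wordBasis, hw, expo_ofFn] at this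
  exact this

theorem degree_expo (l : List ℕ) : (expo l).degree = l.sum := by
  rw [expo, map_sum]
  simp only [Finsupp.degree_single]
  rw [← List.sum_ofFn, List.ofFn_get]

variable (K) in
/-- The operator `f^⊥` on `NSym`, adjoint to the multiplication by `f` on `QSym`:
`f^⊥ a = ∑_β ⟨a, f M_β⟩ H_β`. For `a = H_w` only the compositions `β` of integers `m ≤ |w|` can
contribute, as `⟨H_w, f M_β⟩ = 0` for `|β| > |w|`. -/
def perp (f : QSym K) : NSym K →ₗ[K] NSym K :=
  (wordBasis K).constr K fun w => ∑ m ∈ Finset.range ((parts w).sum + 1), ∑ β : Composition m,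
    pairing K (wordBasis K w) (f * monomialQSym K β) • HSeq K (seq β)

theorem perp_wordBasis (f : QSym K) (w : FreeMonoid ℕ+) :
    perp K f (wordBasis K w) = ∑ m ∈ Finset.range ((parts w).sum + 1), ∑ β : Composition m,
      pairing K (wordBasis K w) (f * monomialQSym K β) • HSeq K (seq β) := by
  rw [perp, Module.Basis.constr_basis]

theorem sum_composition_delta (w : FreeMonoid ℕ+) (N : ℕ) (hN : (parts w).sum ≤ N)
    (c : ∀ m, Composition m → K) (g : List ℕ → K) (hc : ∀ m (β : Composition m), c m β = g β.blocks) :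
    (∑ m ∈ Finset.range (N + 1), ∑ β : Composition m,
      c m β * (if parts w = β.blocks then 1 else 0)) = g (parts w) := by
  rw [Finset.sum_eq_single (parts w).sum, Finset.sum_eq_single (wordComp w)]
  · rw [hc]
    simp [wordComp]
  · intro β _ hβ
    rw [if_neg, mul_zero]
    intro h
    exact hβ (Composition.ext h.symm)
  · simp
  · intro m _ hm
    refine Finset.sum_eq_zero fun β _ => ?_
    rw [if_neg, mul_zero]
    intro h
    exact hm (by rw [h, β.blocks_sum])
  · intro h
    exact absurd (Finset.mem_range.2 (by omega)) h

/-- `f^⊥` is adjoint to the multiplication by `f`. -/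
theorem pairing_perp (f g : QSym K) (a : NSym K) :
    pairing K (perp K f a) g = pairing K a (f * g) := by
  classical
  suffices h : (pairing K).flip g ∘ₗ perp K f = (pairing K).flip (f * g) from
    LinearMap.congr_fun h a
  refine (wordBasis K).ext fun w => ?_
  simp only [LinearMap.comp_apply, LinearMap.flip_apply]
  set N := (parts w).sum with hN
  let g' : QSym K := ∑ m ∈ Finset.range (N + 1), ∑ β : Composition m,
    pairing K (HSeq K (seq β)) g • monomialQSym K β
  have hg' : ∀ v, (parts v).sum ≤ N →
      pairing K (wordBasis K v) g' = pairing K (wordBasis K v) g := by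
    intro v hv
    simp only [g', map_sum, map_smul, smul_eq_mul, pairing_wordBasis_monomial]
    rw [wordBasis_eq_HSeq]
    exact sum_composition_delta v N hv (fun _ β => pairing K (HSeq K (seq β)) g)
      (fun l => pairing K (HSeq K (l.map (Nat.cast : ℕ → ℤ))) g) (fun _ _ => rfl)
  have hcoeff : ∀ d : ℕ →₀ ℕ, d.degree ≤ N →
      MvPowerSeries.coeff d g'.1 = MvPowerSeries.coeff d g.1 := by
    intro d hd
    obtain ⟨k, b, j, hb, hj, rfl⟩ := exists_eq_sum_single d
    rw [g'.2.1 k b j hb hj, g.2.1 k b j hb hj]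
    obtain ⟨v, hv⟩ := exists_word (List.ofFn b) (by
      intro x hx
      obtain ⟨i, rfl⟩ := (List.mem_ofFn' _ _).1 hx
      exact hb i)
    have := hg' v (by
      rw [hv, List.sum_ofFn]
      simpa only [map_sum, Finsupp.degree_single] using hd)
    rwa [pairing_wordBasis, pairing_wordBasis, hv, expo_ofFn] at this
  have hfg : pairing K (wordBasis K w) (f * g) = pairing K (wordBasis K w) (f * g') := by
    rw [pairing_wordBasis, pairing_wordBasis]
    change MvPowerSeries.coeff _ (f.1 * g.1) = MvPowerSeries.coeff _ (f.1 * g'.1)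
    rw [MvPowerSeries.coeff_mul, MvPowerSeries.coeff_mul]
    refine Finset.sum_congr rfl fun p hp => ?_
    rw [hcoeff]
    have h1 := congrArg Finsupp.degree (Finset.HasAntidiagonal.mem_antidiagonal.1 hp)
    rw [map_add, degree_expo] at h1
    omega
  rw [hfg, perp_wordBasis]
  simp only [g', map_sum, map_smul, LinearMap.sum_apply, LinearMap.smul_apply, Finset.mul_sum,
    mul_smul_comm, smul_eq_mul]
  exact Finset.sum_congr rfl fun m _ => Finset.sum_congr rfl fun β _ => mul_comm _ _

theorem blocks_eq_ones {i : ℕ} (β : Composition i)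
    (h : (Composition.ones i).boundaries ⊆ β.boundaries) : β = Composition.ones i := by
  apply (compositionEquiv i).injective
  apply CompositionAsSet.ext
  refine (Finset.Subset.antisymm h ?_).symm
  have hc : (Composition.ones i).boundaries = Finset.univ := by
    rw [← Finset.card_eq_iff_eq_univ, Composition.card_boundaries_eq_succ_length]
    simp
  exact hc ▸ Finset.subset_univ _

/-- `F_{1^i} = M_{1^i}`. -/
theorem fundamentalQSym_ones (i : ℕ) :
    fundamentalQSym K (Composition.ones i) = monomialQSym K (Composition.ones i) := by
  rw [fundamentalQSym, Finset.sum_eq_single (Composition.ones i)]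
  · intro β hβ hne
    exact absurd (blocks_eq_ones β (Finset.mem_filter.1 hβ).2) hne
  · simp

theorem pairing_mul_monomial_eq_zero (w : FreeMonoid ℕ+) {m n : ℕ} (α : Composition m)
    (β : Composition n) (h : (parts w).sum ≠ m + n) :
    pairing K (wordBasis K w) (monomialQSym K α * monomialQSym K β) = 0 := by
  classical
  rw [pairing_wordBasis]
  change MvPowerSeries.coeff _ (monomialSeries K α * monomialSeries K β) = 0
  rw [MvPowerSeries.coeff_mul]
  refine Finset.sum_eq_zero fun p hp => ?_
  by_contra hne
  have h1 := degree_of_coeff_monomialSeries_ne_zero α _ (left_ne_zero_of_mul hne)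
  have h2 := degree_of_coeff_monomialSeries_ne_zero β _ (right_ne_zero_of_mul hne)
  have h3 := congrArg Finsupp.degree (Finset.HasAntidiagonal.mem_antidiagonal.1 hp)
  rw [map_add, degree_expo, h1, h2] at h3
  exact h h3.symm

/-- `F_{1^i}^⊥` kills everything of degree less than `i`. -/
theorem perp_ones_eq_zero (w : FreeMonoid ℕ+) (i : ℕ) (h : (parts w).sum < i) :
    perp K (fundamentalQSym K (Composition.ones i)) (wordBasis K w) = 0 := by
  rw [perp_wordBasis, fundamentalQSym_ones]
  refine Finset.sum_eq_zero fun m _ => Finset.sum_eq_zero fun β _ => ?_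
  rw [pairing_mul_monomial_eq_zero w _ _ (by omega), zero_smul]

variable (K) in
/-- The noncommutative Bernstein operator `∑_{i ≥ 0} (-1)^i H_{m+i} F_{1^i}^⊥`. On the word basis
the terms with `i` greater than the degree of the word vanish and are left out. -/
def bernstein (m : ℤ) : NSym K →ₗ[K] NSym K :=
  (wordBasis K).constr K fun w => ∑ i ∈ Finset.range ((parts w).sum + 1),
    (-1 : K) ^ i •
      (H K (m + i) * perp K (fundamentalQSym K (Composition.ones i)) (wordBasis K w))

theorem bernstein_wordBasis (m : ℤ) (w : FreeMonoid ℕ+) {N : ℕ} (hN : (parts w).sum < N) :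
    bernstein K m (wordBasis K w) = ∑ i ∈ Finset.range N, (-1 : K) ^ i •
      (H K (m + i) * perp K (fundamentalQSym K (Composition.ones i)) (wordBasis K w)) := by
  rw [bernstein, Module.Basis.constr_basis]
  refine Finset.sum_subset (Finset.range_subset_range.2 hN) fun i _ hi => ?_
  rw [Finset.mem_range] at hi
  rw [perp_ones_eq_zero w i (by omega), mul_zero, smul_zero]

variable (K) in
/-- The immaculate function of an integer sequence: `𝔹_{μ₁} ⋯ 𝔹_{μ_k} (1)`. -/
def immaculate (μ : List ℤ) : NSym K := μ.foldr (fun m a => bernstein K m a) 1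

/-! ### The dual immaculate functions -/

variable (K) in
def wordSpan (P : List ℕ → Prop) : Submodule K (NSym K) :=
  Submodule.span K (wordBasis K '' {w | P (parts w)})

theorem wordBasis_mem {P : List ℕ → Prop} {w : FreeMonoid ℕ+} (h : P (parts w)) :
    wordBasis K w ∈ wordSpan K P := Submodule.subset_span ⟨w, h, rfl⟩

theorem wordSpan_le {P : List ℕ → Prop} {S : Submodule K (NSym K)}
    (h : ∀ w, P (parts w) → wordBasis K w ∈ S) : wordSpan K P ≤ S := by
  rw [wordSpan, Submodule.span_le]
  rintro _ ⟨w, hw, rfl⟩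
  exact h w hw

theorem perp_ones_zero (w : FreeMonoid ℕ+) :
    perp K (fundamentalQSym K (Composition.ones 0)) (wordBasis K w) = wordBasis K w := by
  have h1 : fundamentalQSym K (Composition.ones 0) = 1 := by
    rw [fundamentalQSym_ones]
    apply Subtype.ext
    ext d
    classical
    change MvPowerSeries.coeff d (monomialSeries K (Composition.ones 0)) =
      MvPowerSeries.coeff d 1
    rw [coeff_monomialSeries, MvPowerSeries.coeff_one]
    congr 1
    refine propext ⟨?_, ?_⟩
    · rintro ⟨j, -, rfl⟩
      rw [← Finsupp.degree_eq_zero_iff, map_sum]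
      simp only [Finsupp.degree_single]
      exact (Composition.ones 0).sum_blocksFun
    · rintro rfl
      have he : IsEmpty (Fin (Composition.ones 0).length) := by
        rw [Composition.ones_length]; infer_instance
      exact ⟨fun i => he.elim i, fun a => he.elim a, by simp⟩
  rw [h1, perp_wordBasis]
  simp only [one_mul, pairing_wordBasis_monomial]
  rw [Finset.sum_eq_single (parts w).sum, Finset.sum_eq_single (wordComp w)]
  · have h2 : parts w = (wordComp w).blocks := rfl
    rw [if_pos h2, one_smul, wordBasis_eq_HSeq]
    rfl
  · intro β _ hβ
    rw [if_neg, zero_smul]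
    intro h
    exact hβ (Composition.ext h.symm)
  · simp
  · intro m _ hm
    refine Finset.sum_eq_zero fun β _ => ?_
    rw [if_neg, zero_smul]
    intro h
    exact hm (by rw [h, β.blocks_sum])
  · intro h
    exact absurd (Finset.mem_range.2 (by omega)) h

theorem bernstein_sub_mem (m : ℕ) (hm : 0 < m) (n : ℕ) {a : NSym K}
    (ha : a ∈ wordSpan K (fun l => l.sum = n)) (l : List ℕ) :
    bernstein K m a - H K m * a ∈ wordSpan K (fun l' => l'.sum = m + n ∧ m :: l < l') := by
  suffices h : wordSpan K (fun l => l.sum = n) ≤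
      (wordSpan K (fun l' => l'.sum = m + n ∧ m :: l < l')).comap
        (bernstein K m - LinearMap.mulLeft K (H K m)) from h ha
  refine wordSpan_le fun w hw => ?_
  rw [Submodule.mem_comap, LinearMap.sub_apply, LinearMap.mulLeft_apply,
    bernstein_wordBasis (m : ℤ) w (Nat.lt_succ_self _), Finset.sum_range_succ']
  simp only [pow_zero, one_smul, Nat.cast_zero, add_zero, perp_ones_zero, add_sub_cancel_right]
  refine Submodule.sum_mem _ fun i _ => Submodule.smul_mem _ _ ?_
  rw [perp_wordBasis, Finset.mul_sum]
  refine Submodule.sum_mem _ fun s _ => ?_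
  rw [Finset.mul_sum]
  refine Submodule.sum_mem _ fun β _ => ?_
  rw [mul_smul_comm]
  by_cases hs : (parts w).sum = (i + 1) + s
  · refine Submodule.smul_mem _ _ ?_
    obtain ⟨v, hv, hvs, h⟩ := exists_word_comp (K := K) β
    obtain ⟨p, hp⟩ : ∃ p : ℕ+, (p : ℕ) = m + (i + 1) := ⟨⟨m + (i + 1), by omega⟩, rfl⟩
    have hH : H K ((m : ℤ) + ((i + 1 : ℕ) : ℤ)) = wordBasis K (FreeMonoid.of p) := by
      rw [← H_pnat, hp]
      push_cast
      rfl
    rw [h, hH, ← wordBasis_mul]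
    apply wordBasis_mem
    rw [parts_of_mul, hp]
    refine ⟨?_, ?_⟩
    · rw [List.sum_cons, hvs]
      omega
    · exact List.cons_lt_cons_iff.2 (Or.inl (by omega))
  · rw [fundamentalQSym_ones, pairing_mul_monomial_eq_zero w _ _ hs, zero_smul]
    exact Submodule.zero_mem _

theorem HSeq_mem (l : List ℕ) (hl : ∀ a ∈ l, 0 < a) :
    HSeq K (l.map (Nat.cast : ℕ → ℤ)) ∈ wordSpan K (fun l' => l'.sum = l.sum) := by
  obtain ⟨w, rfl⟩ := exists_word l hl
  rw [← wordBasis_eq_HSeq]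
  exact wordBasis_mem rfl

/-- The expansion of the immaculates into the `H_α` is unitriangular for the lexicographic
order. -/
theorem immaculate_sub_mem (l : List ℕ) (hl : ∀ a ∈ l, 0 < a) :
    immaculate K (l.map (Nat.cast : ℕ → ℤ)) - HSeq K (l.map (Nat.cast : ℕ → ℤ)) ∈
      wordSpan K (fun l' => l'.sum = l.sum ∧ l < l') := by
  induction l with
  | nil => simp [immaculate, HSeq]
  | cons m l ih =>
    have hl' : ∀ a ∈ l, 0 < a := fun a ha => hl a (List.mem_cons_of_mem _ ha)
    have hm : 0 < m := hl m List.mem_cons_self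
    have ih := ih hl'
    have hmem : immaculate K (l.map (Nat.cast : ℕ → ℤ)) ∈ wordSpan K (fun l' => l'.sum = l.sum) := by
      have h1 : wordSpan K (fun l' => l'.sum = l.sum ∧ l < l') ≤
          wordSpan K (fun l' => l'.sum = l.sum) := wordSpan_le fun w hw => wordBasis_mem hw.1
      have := Submodule.add_mem _ (h1 ih) (HSeq_mem l hl')
      rwa [sub_add_cancel] at this
    have h2 := bernstein_sub_mem m hm l.sum hmem l
    have h3 : H K m * (immaculate K (l.map (Nat.cast : ℕ → ℤ)) - HSeq K (l.map (Nat.cast : ℕ → ℤ)))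
        ∈ wordSpan K (fun l' => l'.sum = m + l.sum ∧ m :: l < l') := by
      suffices h : wordSpan K (fun l' => l'.sum = l.sum ∧ l < l') ≤
          (wordSpan K (fun l' => l'.sum = m + l.sum ∧ m :: l < l')).comap
            (LinearMap.mulLeft K (H K m)) from h ih
      refine wordSpan_le fun w hw => ?_
      obtain ⟨p, hp⟩ : ∃ p : ℕ+, (p : ℕ) = m := ⟨⟨m, hm⟩, rfl⟩
      have hH : H K (m : ℤ) = wordBasis K (FreeMonoid.of p) := by rw [← H_pnat, hp]
      rw [Submodule.mem_comap, LinearMap.mulLeft_apply, hH, ← wordBasis_mul]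
      apply wordBasis_mem
      rw [parts_of_mul, hp]
      refine ⟨?_, ?_⟩
      · rw [List.sum_cons, hw.1]
      · exact List.cons_lt_cons_iff.2 (Or.inr ⟨rfl, hw.2⟩)
    have h4 := Submodule.add_mem _ h2 h3
    have h5 : immaculate K ((m :: l).map (Nat.cast : ℕ → ℤ)) =
        bernstein K m (immaculate K (l.map (Nat.cast : ℕ → ℤ))) := rfl
    have h6 : HSeq K ((m :: l).map (Nat.cast : ℕ → ℤ)) =
        H K m * HSeq K (l.map (Nat.cast : ℕ → ℤ)) := by
      simp only [HSeq, List.map_cons, List.prod_cons]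
    rw [h5, h6, List.sum_cons]
    convert h4 using 1
    rw [mul_sub]
    abel

theorem immaculate_mem {n : ℕ} (μ : Composition n) :
    immaculate K (seq μ) ∈ wordSpan K (fun l => l.sum = n) := by
  have h1 : wordSpan K (fun l' => l'.sum = μ.blocks.sum ∧ μ.blocks < l') ≤
      wordSpan K (fun l' => l'.sum = μ.blocks.sum) := wordSpan_le fun w hw => wordBasis_mem hw.1
  have := Submodule.add_mem _ (h1 (immaculate_sub_mem (K := K) μ.blocks fun a ha => μ.blocks_pos ha))
    (HSeq_mem (K := K) μ.blocks fun a ha => μ.blocks_pos ha)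
  rw [sub_add_cancel, μ.blocks_sum] at this
  exact this

theorem pairing_eq_sum {n : ℕ} {a : NSym K} (ha : a ∈ wordSpan K (fun l => l.sum = n))
    (f : QSym K) : pairing K a f =
      ∑ α : Composition n, pairing K a (monomialQSym K α) * pairing K (HSeq K (seq α)) f := by
  suffices h : wordSpan K (fun l => l.sum = n) ≤ LinearMap.eqLocus ((pairing K).flip f)
      (∑ α : Composition n, pairing K (HSeq K (seq α)) f • (pairing K).flip (monomialQSym K α)) by
    have := h ha
    rw [LinearMap.mem_eqLocus] at this
    simpa [mul_comm] using this
  refine wordSpan_le fun w hw => ?_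
  subst hw
  rw [LinearMap.mem_eqLocus]
  simp only [LinearMap.flip_apply, LinearMap.sum_apply, LinearMap.smul_apply, smul_eq_mul,
    pairing_wordBasis_monomial]
  rw [Finset.sum_eq_single (wordComp w)]
  · have h1 : parts w = (wordComp w).blocks := rfl
    rw [if_pos h1, mul_one, wordBasis_eq_HSeq]
    rfl
  · intro β _ hβ
    rw [if_neg, mul_zero]
    intro h
    exact hβ (Composition.ext h.symm)
  · simp

variable (K) in
def immaculateMatrix (n : ℕ) : Matrix (Composition n) (Composition n) K :=
  fun μ α => pairing K (immaculate K (seq μ)) (monomialQSym K α)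

theorem immaculateMatrix_eq {n : ℕ} (μ α : Composition n) (h : ¬ μ.blocks < α.blocks) :
    immaculateMatrix K n μ α = if μ.blocks = α.blocks then 1 else 0 := by
  rw [immaculateMatrix, ← sub_add_cancel (immaculate K (seq μ)) (HSeq K (seq μ)), map_add,
    LinearMap.add_apply, pairing_H_monomial, add_eq_right]
  suffices h : wordSpan K (fun l' => l'.sum = μ.blocks.sum ∧ μ.blocks < l') ≤
      LinearMap.ker ((pairing K).flip (monomialQSym K α)) from
    h (immaculate_sub_mem (K := K) μ.blocks fun a ha => μ.blocks_pos ha)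
  refine wordSpan_le fun w hw => ?_
  rw [LinearMap.mem_ker, LinearMap.flip_apply, pairing_wordBasis_monomial, if_neg]
  intro he
  exact h (he ▸ hw.2)

theorem det_immaculateMatrix (n : ℕ) : (immaculateMatrix K n).det = 1 := by
  let _ : LinearOrder (Composition n) :=
    LinearOrder.lift' Composition.blocks fun _ _ h => Composition.ext h
  rw [Matrix.det_of_isUpperTriangular]
  · refine Finset.prod_eq_one fun μ _ => ?_
    rw [immaculateMatrix_eq _ _ (lt_irrefl _), if_pos rfl]
  · intro μ α hμα
    have hlt : α.blocks < μ.blocks := hμα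
    rw [immaculateMatrix_eq _ _ hlt.asymm, if_neg hlt.ne']

/-- For every composition `β` there is exactly one quasisymmetric function `f` with
`⟨𝔖_μ, f⟩ = δ_{μβ}` for all compositions `μ`. -/
theorem existsUnique_dual (K : Type*) [CommRing K] {n : ℕ} (β : Composition n) :
    ∃! f : QSym K, ∀ (m : ℕ) (μ : Composition m),
      pairing K (immaculate K (seq μ)) f = if μ.blocks = β.blocks then 1 else 0 := by
  have hdet : ∀ m, IsUnit (immaculateMatrix K m).det := fun m => by
    rw [det_immaculateMatrix]; exact isUnit_one
  have hex : ∀ (m : ℕ) (μ : Composition m), pairing K (immaculate K (seq μ))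
      (∑ α : Composition n, (immaculateMatrix K n)⁻¹ α β • monomialQSym K α) =
        if μ.blocks = β.blocks then 1 else 0 := by
    intro m μ
    simp only [map_sum, map_smul, smul_eq_mul]
    by_cases hmn : m = n
    · subst hmn
      have h1 := congrFun (congrFun (Matrix.mul_nonsing_inv _ (hdet m)) μ) β
      rw [Matrix.mul_apply, Matrix.one_apply] at h1
      simp only [Composition.ext_iff] at h1
      rw [← h1]
      exact Finset.sum_congr rfl fun α _ => mul_comm _ _
    · rw [if_neg]
      · refine Finset.sum_eq_zero fun α _ => ?_
        suffices h : wordSpan K (fun l => l.sum = m) ≤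
            LinearMap.ker ((pairing K).flip (monomialQSym K α)) by
          have := h (immaculate_mem μ)
          rw [LinearMap.mem_ker, LinearMap.flip_apply] at this
          rw [this, mul_zero]
        refine wordSpan_le fun w hw => ?_
        rw [LinearMap.mem_ker, LinearMap.flip_apply, pairing_wordBasis_monomial, if_neg]
        intro he
        exact hmn (by rw [← hw, he, α.blocks_sum])
      · intro he
        exact hmn (by rw [← μ.blocks_sum, he, β.blocks_sum])
  refine ⟨_, hex, fun g hg => ?_⟩
  have huniq : ∀ (g₁ g₂ : QSym K), (∀ (m : ℕ) (μ : Composition m),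
      pairing K (immaculate K (seq μ)) g₁ = pairing K (immaculate K (seq μ)) g₂) → g₁ = g₂ := by
    intro g₁ g₂ h
    refine qsym_ext fun w => ?_
    have hv : (immaculateMatrix K (parts w).sum).mulVec
        (fun α => pairing K (HSeq K (seq α)) g₁) = (immaculateMatrix K (parts w).sum).mulVec
        (fun α => pairing K (HSeq K (seq α)) g₂) := by
      funext μ
      have := h _ μ
      rw [pairing_eq_sum (immaculate_mem μ) g₁, pairing_eq_sum (immaculate_mem μ) g₂] at this
      exact this
    have h2 := congrArg ((immaculateMatrix K (parts w).sum)⁻¹.mulVec) hv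
    rw [Matrix.mulVec_mulVec, Matrix.mulVec_mulVec, Matrix.nonsing_inv_mul _ (hdet _),
      Matrix.one_mulVec, Matrix.one_mulVec] at h2
    have h3 := congrFun h2 (wordComp w)
    rw [wordBasis_eq_HSeq]
    exact h3
  exact huniq _ _ fun m μ => (hg m μ).trans (hex m μ).symm

/-- The dual immaculate quasisymmetric function `𝔖*_β`: the members of the basis of `QSym` dual to
the immaculate basis of `NSym`. -/
def dualImmaculate (K : Type*) [CommRing K] {n : ℕ} (β : Composition n) : QSym K :=
  (existsUnique_dual K β).choose

/-- `⟨𝔖_μ, 𝔖*_β⟩ = δ_{μβ}`. -/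
theorem pairing_immaculate_dualImmaculate (K : Type*) [CommRing K] {m n : ℕ} (μ : Composition m)
    (β : Composition n) : pairing K (immaculate K (seq μ)) (dualImmaculate K β) =
      if μ.blocks = β.blocks then 1 else 0 :=
  (existsUnique_dual K β).choose_spec.1 m μ

end NSymDef

/-! ### Diagrams, tunnel hooks and tunnel hook coverings

Throughout, `μ : Fin k → ℤ` is the outer shape and `ν : Fin k → ℕ` the inner one. Rows are
numbered by `Fin k` (so the row called `r + 1` in mathematical writing is `r` here), columns are
numbered from `1`. A cell is a pair (row, column). The partial diagram whose lowest row is `r` only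
involves the rows `p ≥ r`. -/

section TunnelHooks

variable {k : ℕ}

/-- The number of grey cells in row `i`. -/
def greyCount (ν : Fin k → ℕ) (i : Fin k) : ℕ := ν i

/-- The number of blue cells in row `i`. -/
def blueCount (μ : Fin k → ℤ) (ν : Fin k → ℕ) (i : Fin k) : ℕ :=
  if 0 < μ i ∧ (ν i : ℤ) ≤ μ i then (μ i - ν i).toNat else 0

/-- The number of red cells in row `i`. -/
def redCount (μ : Fin k → ℤ) (ν : Fin k → ℕ) (i : Fin k) : ℕ :=
  if 0 < μ i then (if μ i < ν i then (ν i - μ i).toNat else 0) else (μ i).natAbs + ν i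

/-- The columns of the boundary cells in row `p` of the partial diagram with lowest row `r`. -/
def boundaryColumns (μ : Fin k → ℤ) (ν : Fin k → ℕ) (r p : Fin k) : Finset ℕ :=
  if p = r then
    Finset.Icc (ν r + 1) (max (ν r + 1) (greyCount ν r + blueCount μ ν r + redCount μ ν r))
  else if r < p then
    Finset.Icc (ν p + 1) (ν ⟨(p : ℕ) - 1, (Nat.sub_le _ _).trans_lt p.isLt⟩ + 1)
  else ∅

def boundaryCells (μ : Fin k → ℤ) (ν : Fin k → ℕ) (r : Fin k) : Finset (Fin k × ℕ) :=
  Finset.univ.biUnion fun p => (boundaryColumns μ ν r p).image fun q => (p, q)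

/-- The boundary cells `(p, q)` with `q = ν_p + 1`. -/
def tunnelCells (μ : Fin k → ℤ) (ν : Fin k → ℕ) (r : Fin k) : Finset (Fin k × ℕ) :=
  (boundaryCells μ ν r).filter fun c => c.2 = ν c.1 + 1

/-- The tunnel hook that starts in row `r` and has terminal cell `τ`: all boundary cells in the rows
from `r` to the row of `τ`. -/
def tunnelHook (μ : Fin k → ℤ) (ν : Fin k → ℕ) (r : Fin k) (τ : Fin k × ℕ) :
    Finset (Fin k × ℕ) :=
  (boundaryCells μ ν r).filter fun c => r ≤ c.1 ∧ c.1 ≤ τ.1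

/-- The sign `(-1)^{p - r}` of the tunnel hook that starts in row `r` and ends in row `p`. -/
def hookSign (r : Fin k) (τ : Fin k × ℕ) : ℤ := (-1) ^ ((τ.1 : ℕ) - (r : ℕ))

/-- The value of the tunnel hook that starts in row `r` and has terminal cell `τ = (p, q)`:
`(#blue - #red in row r) + (ν_r + 1 - q) + (p - r)`. -/
def hookValue (μ : Fin k → ℤ) (ν : Fin k → ℕ) (r : Fin k) (τ : Fin k × ℕ) : ℤ :=
  ((blueCount μ ν r : ℤ) - redCount μ ν r) + ((ν r : ℤ) + 1 - τ.2) +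
    (((τ.1 : ℕ) : ℤ) - ((r : ℕ) : ℤ))

/-- The inner shape after the first `s` tunnel hooks have been placed, where the `r`-th hook has
terminal cell `γ r`: it starts empty, and each hook adds its cells. -/
def innerShape (μ : Fin k → ℤ) (γ : Fin k → Fin k × ℕ) : ℕ → Fin k → ℕ
  | 0 => fun _ => 0
  | s + 1 => fun i => innerShape μ γ s i +
      if h : s < k then
        ((tunnelHook μ (innerShape μ γ s) ⟨s, h⟩ (γ ⟨s, h⟩)).filter fun c => c.1 = i).card
      else 0

/-- `γ` lists the terminal cells of a tunnel hook covering of the diagram of `μ`: each `γ r` is a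
tunnel cell of the partial diagram with lowest row `r` that remains after the hooks in the earlier
rows. The covering consists of the hooks that start in row `r` and end in `γ r`, so it is determined
by the `γ r`, and it determines them. -/
def IsTunnelHookCovering (μ : Fin k → ℤ) (γ : Fin k → Fin k × ℕ) : Prop :=
  ∀ r : Fin k, γ r ∈ tunnelCells μ (innerShape μ γ r) r

theorem isTunnelHookCovering_ext {μ : Fin k → ℤ} {γ δ : Fin k → Fin k × ℕ}
    (hγ : IsTunnelHookCovering μ γ) (hδ : IsTunnelHookCovering μ δ)
    (h : ∀ r, (γ r).1 = (δ r).1) : γ = δ := by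
  have key : ∀ r : Fin k, innerShape μ γ r = innerShape μ δ r → γ r = δ r := by
    intro r hr
    have h1 := (Finset.mem_filter.1 (hγ r)).2
    have h2 := (Finset.mem_filter.1 (hδ r)).2
    exact Prod.ext (h r) (by rw [h1, h2, hr, h r])
  have hs : ∀ s : ℕ, innerShape μ γ s = innerShape μ δ s := by
    intro s
    induction s with
    | zero => rfl
    | succ s ih =>
      funext i
      simp only [innerShape, ih]
      by_cases hsk : s < k
      · simp only [hsk, dite_true]
        rw [key ⟨s, hsk⟩ ih]
      · simp only [hsk, dite_false]
  exact funext fun r => key r (hs r)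

theorem finite_tunnelHookCoverings (μ : Fin k → ℤ) : {γ | IsTunnelHookCovering μ γ}.Finite := by
  refine Set.Finite.of_injOn (f := fun γ r => (γ r).1) (t := Set.univ)
    (fun _ _ => Set.mem_univ _) (fun γ hγ δ hδ h => ?_) Set.finite_univ
  exact isTunnelHookCovering_ext hγ hδ fun r => congrFun h r

/-- The set of all tunnel hook coverings of the diagram of `μ`. -/
def tunnelHookCoverings (μ : Fin k → ℤ) : Finset (Fin k → Fin k × ℕ) :=
  (finite_tunnelHookCoverings μ).toFinset

theorem mem_tunnelHookCoverings {μ : Fin k → ℤ} {γ : Fin k → Fin k × ℕ} :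
    γ ∈ tunnelHookCoverings μ ↔ IsTunnelHookCovering μ γ :=
  (finite_tunnelHookCoverings μ).mem_toFinset

/-- The sequence `Δ(γ)` of the values of the hooks of a covering. -/
def coveringValue (μ : Fin k → ℤ) (γ : Fin k → Fin k × ℕ) : List ℤ :=
  List.ofFn fun r => hookValue μ (innerShape μ γ r) r (γ r)

/-- The product of the signs of the hooks of a covering. -/
def coveringSign (γ : Fin k → Fin k × ℕ) : ℤ := ∏ r, hookSign r (γ r)

/-- The sequence `a` with its zeros removed. -/
def flatten (a : List ℤ) : List ℤ := a.filter fun x => x ≠ 0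

/-- The parts of a composition as a function on the rows of its diagram. -/
def shape {n : ℕ} (μ : Composition n) : Fin μ.length → ℤ := fun i => (μ.blocksFun i : ℤ)

end TunnelHooks

end QSymNSym

end

/-! The immaculate and dual immaculate functions are dual bases, so the coefficient of `𝔖*_μ` in
`M_α` is `⟨𝔖_μ, M_α⟩` (`monomialQSym_eq_sum_dualImmaculate`). Hence it suffices to expand `𝔖_μ` as a
signed sum of products `H_a` over integer sequences `a`. Since `H_0 = 1` and `H_m = 0` for `m < 0`,
the product `H_a` pairs to `1` with `M_α` if `fl(a) = α` and to `0` otherwise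
(`pairing_HSeq_monomial`).

The expansion comes from a noncommutative Jacobi–Trudi determinant with entries `H_{μ_r - r + s}`
(`immaculate_eq_rowDet`). It rests on the product rule `onesPerp_H_mul`: `F_{1^i}^⊥` either passes
`H_a` or lowers `a` by one. On a determinant this lowers `i` columns in all ways; when the columns
are consecutive, all choices but the first `i` columns give two equal columns. The Bernstein sum
thus becomes the expansion along a new first row.

Expanding the determinant completely means to pick, row by row, one of the columns still left
(`rowDet_eq_sum_deletions`). Tunnel hooks do the same: after some hooks have been placed, the
numbers `p - ν_p` for the rows `p` not yet treated are exactly the column labels left, and a hook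
that ends in row `p` removes the label of row `p` (`innerShape_spec`). Its value is `μ_r - r + (p -
ν_p)`, the index of the chosen entry, and its sign is the sign of the cofactor. So coverings and
terms of the determinant correspond one to one (`sum_tunnelHookCoverings`). -/

noncomputable section

namespace QSymNSym

/-! ### Left multiplication by `H_a` and the product rule for `F_{1^i}^⊥` -/

section LeftSkewing

variable {K : Type*} [CommRing K]

/-- The exponent vector of `x₁^a` times the monomial `d` in the variables `x₂, x₃, …`. -/
def consExpo (a : ℕ) (d : ℕ →₀ ℕ) : ℕ →₀ ℕ :=
  Finsupp.single 0 a + d.mapDomain Nat.succ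

theorem consExpo_zero_apply (a : ℕ) (d : ℕ →₀ ℕ) : consExpo a d 0 = a := by
  rw [consExpo, Finsupp.add_apply, Finsupp.single_eq_same,
    Finsupp.mapDomain_of_notMem_range _ _ (by simp), add_zero]

theorem consExpo_succ_apply (a : ℕ) (d : ℕ →₀ ℕ) (i : ℕ) : consExpo a d (i + 1) = d i := by
  rw [consExpo, Finsupp.add_apply, Finsupp.single_eq_of_ne (by simp), zero_add]
  exact Finsupp.mapDomain_apply Nat.succ_injective d i

theorem consExpo_injective2 {a b : ℕ} {d e : ℕ →₀ ℕ} (h : consExpo a d = consExpo b e) :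
    a = b ∧ d = e := by
  constructor
  · simpa [consExpo_zero_apply] using DFunLike.congr_fun h 0
  · ext i
    simpa [consExpo_succ_apply] using DFunLike.congr_fun h (i + 1)

theorem exists_consExpo (u : ℕ →₀ ℕ) : ∃ a d, consExpo a d = u := by
  refine ⟨u 0, u.comapDomain Nat.succ Nat.succ_injective.injOn, ?_⟩
  ext i
  cases i with
  | zero => rw [consExpo_zero_apply]
  | succ i => rw [consExpo_succ_apply]; rfl

theorem consExpo_add (a b : ℕ) (d e : ℕ →₀ ℕ) :
    consExpo a d + consExpo b e = consExpo (a + b) (d + e) := by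
  rw [consExpo, consExpo, consExpo, Finsupp.single_add, Finsupp.mapDomain_add]
  abel

/-- A relabelling of `x₂, x₃, …` extends to all variables by fixing `x₁`, and stays increasing if
`e` is. This passes quasisymmetry from a series to its coefficient of `x₁^a`. -/
theorem consExpo_mapDomain_comm (a : ℕ) (d : ℕ →₀ ℕ) (e : ℕ → ℕ) :
    consExpo a (d.mapDomain e) =
      (consExpo a d).mapDomain (fun n => Nat.casesOn n 0 fun m => e m + 1) := by
  rw [consExpo, consExpo, Finsupp.mapDomain_add, Finsupp.mapDomain_single,
    ← Finsupp.mapDomain_comp, ← Finsupp.mapDomain_comp]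
  rfl

theorem expo_cons (a : ℕ) (l : List ℕ) : expo (a :: l) = consExpo a (expo l) := by
  rw [expo, expo, consExpo, Finsupp.mapDomain_finsetSum]
  simp only [Finsupp.mapDomain_single]
  exact Fin.sum_univ_succ (n := l.length)
    fun i => Finsupp.single (i : ℕ) ((a :: l).get i)

/-- The coefficient of `x₁^a` as a power series in `x₂, x₃, …`. -/
def leftSkewSeries (a : ℕ) (f : MvPowerSeries ℕ K) : MvPowerSeries ℕ K :=
  fun d => MvPowerSeries.coeff (consExpo a d) f

theorem coeff_leftSkewSeries (a : ℕ) (f : MvPowerSeries ℕ K) (d : ℕ →₀ ℕ) :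
    MvPowerSeries.coeff d (leftSkewSeries a f) = MvPowerSeries.coeff (consExpo a d) f := rfl

theorem leftSkewSeries_mem (a : ℕ) {f : MvPowerSeries ℕ K} (hf : f ∈ QSym K) :
    leftSkewSeries a f ∈ QSym K := by
  obtain ⟨hq, N, hN⟩ := hf
  refine ⟨?_, N, fun d hd => ?_⟩
  · rw [isQuasisymmetric_iff] at hq ⊢
    intro e he d
    rw [coeff_leftSkewSeries, coeff_leftSkewSeries, consExpo_mapDomain_comm]
    refine hq _ (fun m n hmn => ?_) _
    cases n with
    | zero => omega
    | succ n =>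
      cases m with
      | zero => exact Nat.succ_pos _
      | succ m => exact Nat.succ_lt_succ (he (Nat.lt_of_succ_lt_succ hmn))
  · have h1 := hN _ hd
    have h2 : d.degree = (d.mapDomain Nat.succ).degree :=
      (Finsupp.degree_mapDomain _ _).symm
    rw [consExpo, map_add, ← h2] at h1
    omega

/-- The operator on `QSym` that is adjoint to the left multiplication by `H_a`. -/
def leftSkew (a : ℕ) (f : QSym K) : QSym K := ⟨leftSkewSeries a f.1, leftSkewSeries_mem a f.2⟩

/-- In a product the exponent of `x₁` is shared between the two factors. Dually, this is the
coproduct `H_a ↦ ∑ H_b ⊗ H_{a-b}`. -/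
theorem leftSkew_mul (a : ℕ) (f g : QSym K) :
    leftSkew a (f * g) = ∑ p ∈ Finset.HasAntidiagonal.antidiagonal a, leftSkew p.1 f * leftSkew p.2 g := by
  classical
  apply Subtype.ext
  rw [AddSubmonoidClass.coe_finsetSum]
  ext d
  rw [map_sum]
  change MvPowerSeries.coeff (consExpo a d) (f.1 * g.1) = ∑ p ∈ Finset.HasAntidiagonal.antidiagonal a,
    MvPowerSeries.coeff d (leftSkewSeries p.1 f.1 * leftSkewSeries p.2 g.1)
  simp only [MvPowerSeries.coeff_mul, coeff_leftSkewSeries]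
  rw [← Finset.sum_product']
  symm
  refine Finset.sum_bij (fun x _ => (consExpo x.1.1 x.2.1, consExpo x.1.2 x.2.2)) ?_ ?_ ?_ ?_
  · rintro ⟨⟨b, c⟩, u, v⟩ h
    simp only [Finset.mem_product, Finset.HasAntidiagonal.mem_antidiagonal] at h ⊢
    rw [consExpo_add, h.1, h.2]
  · rintro ⟨⟨b, c⟩, u, v⟩ _ ⟨⟨b', c'⟩, u', v'⟩ _ h
    obtain ⟨h1, h2⟩ := Prod.mk.inj h
    obtain ⟨rfl, rfl⟩ := consExpo_injective2 h1
    obtain ⟨rfl, rfl⟩ := consExpo_injective2 h2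
    rfl
  · rintro ⟨x, y⟩ h
    obtain ⟨b, u, rfl⟩ := exists_consExpo x
    obtain ⟨c, v, rfl⟩ := exists_consExpo y
    simp only [Finset.HasAntidiagonal.mem_antidiagonal, consExpo_add] at h
    obtain ⟨h1, h2⟩ := consExpo_injective2 h
    refine ⟨((b, c), (u, v)), ?_, rfl⟩
    simp only [Finset.mem_product, Finset.HasAntidiagonal.mem_antidiagonal]
    exact ⟨h1, h2⟩
  · rintro _ _
    rfl

theorem H_zero : H K 0 = 1 := by simp [H]

theorem H_of_neg {m : ℤ} (hm : m < 0) : H K m = 0 := by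
  rw [H, dif_neg (by omega), if_neg (by omega)]

theorem pairing_H_mul (a : ℕ) (x : NSym K) (g : QSym K) :
    pairing K (H K a * x) g = pairing K x (leftSkew a g) := by
  suffices h : (pairing K).flip g ∘ₗ LinearMap.mulLeft K (H K a) =
      (pairing K).flip (leftSkew a g) from LinearMap.congr_fun h x
  refine (wordBasis K).ext fun w => ?_
  simp only [LinearMap.comp_apply, LinearMap.flip_apply, LinearMap.mulLeft_apply]
  rw [pairing_wordBasis]
  change _ = MvPowerSeries.coeff (consExpo a (expo (parts w))) g.1
  rcases Nat.eq_zero_or_pos a with rfl | ha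
  -- Here no letter is added to the word: the exponent vector is only moved away from `x₁`, and
  -- quasisymmetry says that this leaves the coefficient unchanged.
  · rw [Nat.cast_zero, H_zero, one_mul, pairing_wordBasis, consExpo, Finsupp.single_zero, zero_add,
      (isQuasisymmetric_iff _).1 g.2.1 _ fun _ _ h => Nat.succ_lt_succ h]
  · obtain ⟨p, rfl⟩ : ∃ p : ℕ+, (p : ℕ) = a := ⟨⟨a, ha⟩, rfl⟩
    rw [H_pnat, ← wordBasis_mul, pairing_wordBasis, parts_of_mul, expo_cons]

/-- Pairing with the `M_α` reads off the coordinates in the word basis. -/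
theorem nsym_ext {x y : NSym K} (h : ∀ g, pairing K x g = pairing K y g) : x = y := by
  refine (wordBasis K).ext_elem fun w => ?_
  suffices hc : (pairing K).flip (monomialQSym K (wordComp w)) = (wordBasis K).coord w by
    have := h (monomialQSym K (wordComp w))
    have hx := LinearMap.congr_fun hc x
    have hy := LinearMap.congr_fun hc y
    simp only [LinearMap.flip_apply, Module.Basis.coord_apply] at hx hy
    rw [← hx, ← hy, this]
  refine (wordBasis K).ext fun v => ?_
  classical
  rw [LinearMap.flip_apply, pairing_wordBasis_monomial, Module.Basis.coord_apply,
    Module.Basis.repr_self, Finsupp.single_apply]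
  exact if_congr parts_injective.eq_iff rfl rfl

variable (K) in
/-- The operator `F_{1^i}^⊥`. -/
def onesPerp (i : ℕ) : NSym K →ₗ[K] NSym K := perp K (fundamentalQSym K (Composition.ones i))

theorem onesPerp_zero (x : NSym K) : onesPerp K 0 x = x := by
  suffices h : onesPerp K 0 = LinearMap.id from LinearMap.congr_fun h x
  exact (wordBasis K).ext fun w => perp_ones_zero w

theorem onesPerp_one (i : ℕ) : onesPerp K i 1 = if i = 0 then 1 else 0 := by
  split_ifs with h
  · rw [h, onesPerp_zero]
  · rw [← wordBasis_one]
    exact perp_ones_eq_zero 1 i (by rw [parts_one, List.sum_nil]; omega)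

theorem pairing_H_mul_ones (a i : ℕ) (w : FreeMonoid ℕ+) (ha : 0 < a) :
    pairing K (H K a * wordBasis K w) (monomialQSym K (Composition.ones i)) =
      if a :: parts w = List.replicate i 1 then 1 else 0 := by
  obtain ⟨p, rfl⟩ : ∃ p : ℕ+, (p : ℕ) = a := ⟨⟨a, ha⟩, rfl⟩
  rw [H_pnat, ← wordBasis_mul, pairing_wordBasis_monomial, parts_of_mul, Composition.ones_blocks]

theorem leftSkew_zero (f : QSym K) : leftSkew 0 f = f := by
  refine qsym_ext fun w => ?_
  rw [← pairing_H_mul, Nat.cast_zero, H_zero, one_mul]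

theorem leftSkew_one_ones (i : ℕ) :
    leftSkew 1 (fundamentalQSym K (Composition.ones (i + 1))) =
      fundamentalQSym K (Composition.ones i) := by
  refine qsym_ext fun w => ?_
  rw [← pairing_H_mul, fundamentalQSym_ones, fundamentalQSym_ones,
    pairing_H_mul_ones _ _ _ Nat.one_pos, pairing_wordBasis_monomial, List.replicate_succ,
    Composition.ones_blocks]
  simp

/-- `F_{1^i} = M_{1^i}` is squarefree, so no variable occurs with exponent two or more. -/
theorem leftSkew_ones_eq_zero (a i : ℕ) :
    leftSkew (a + 2) (fundamentalQSym K (Composition.ones i)) = 0 := by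
  refine qsym_ext fun w => ?_
  rw [← pairing_H_mul, fundamentalQSym_ones, pairing_H_mul_ones _ _ _ (by omega), if_neg, map_zero]
  cases i with
  | zero => simp
  | succ i =>
    rw [List.replicate_succ]
    intro h
    have := (List.cons.inj h).1
    omega

/-- This is `leftSkew_mul` read through the adjunction: only the exponents `0` and `1` of `x₁` occur
in `F_{1^{i+1}}`, which leaves two terms. The conventions for `H_0` and `H_m` with `m < 0` keep the
rule valid for every integer `a`. -/
theorem onesPerp_H_mul (i : ℕ) (a : ℤ) (x : NSym K) :
    onesPerp K (i + 1) (H K a * x) =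
      H K a * onesPerp K (i + 1) x + H K (a - 1) * onesPerp K i x := by
  rcases lt_trichotomy a 0 with ha | rfl | ha
  · rw [H_of_neg ha, H_of_neg (by omega : a - 1 < 0)]
    simp
  · rw [H_zero, H_of_neg (by omega : (0 : ℤ) - 1 < 0)]
    simp
  · obtain ⟨b, rfl⟩ : ∃ b : ℕ, a = ((b + 1 : ℕ) : ℤ) := ⟨(a - 1).toNat, by omega⟩
    have hb : ((b + 1 : ℕ) : ℤ) - 1 = (b : ℤ) := by push_cast; ring
    refine nsym_ext fun g => ?_
    rw [hb, map_add, LinearMap.add_apply, onesPerp, onesPerp, pairing_perp, pairing_H_mul,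
      pairing_H_mul, pairing_H_mul, pairing_perp, pairing_perp, leftSkew_mul,
      Finset.Nat.sum_antidiagonal_succ, leftSkew_zero, map_add]
    congr 2
    cases b with
    | zero =>
      rw [Finset.Nat.antidiagonal_zero, Finset.sum_singleton, zero_add, leftSkew_one_ones]
    | succ b =>
      rw [Finset.Nat.sum_antidiagonal_succ, zero_add, leftSkew_one_ones]
      simp only [add_assoc, Nat.reduceAdd]
      simp only [leftSkew_ones_eq_zero, zero_mul, Finset.sum_const_zero, add_zero]

/-- On a word the sum stops at its degree. A linear combination of words needs a common bound, so
the statement allows every sufficiently large one. -/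
theorem exists_bernstein_eq_sum (m : ℤ) (x : NSym K) : ∃ N₀ : ℕ, ∀ N, N₀ ≤ N →
    bernstein K m x = ∑ i ∈ Finset.range N, (-1 : K) ^ i • (H K (m + i) * onesPerp K i x) := by
  induction (wordBasis K).mem_span x using Submodule.span_induction with
  | zero => exact ⟨0, fun N _ => by simp⟩
  | mem x hx =>
    obtain ⟨w, rfl⟩ := hx
    exact ⟨(parts w).sum + 1, fun N hN => bernstein_wordBasis m w hN⟩
  | add x y _ _ hx hy =>
    obtain ⟨A, hA⟩ := hx
    obtain ⟨B, hB⟩ := hy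
    refine ⟨max A B, fun N hN => ?_⟩
    rw [map_add, hA N (by omega), hB N (by omega), ← Finset.sum_add_distrib]
    simp only [map_add, mul_add, smul_add]
  | smul c x _ hx =>
    obtain ⟨A, hA⟩ := hx
    refine ⟨A, fun N hN => ?_⟩
    rw [map_smul, hA N hN, Finset.smul_sum]
    simp only [map_smul, mul_smul_comm, smul_comm c]

end LeftSkewing

/-! ### Noncommutative determinants and the Jacobi–Trudi identity -/

section RowDeterminant

variable {K : Type*} [CommRing K]

variable (K) in
/-- The noncommutative determinant with the entry `H_{a_r + c_s}` in row `r` and column `s`: the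
factors of each product are ordered by rows. -/
def rowDet : (k : ℕ) → (Fin k → ℤ) → (Fin k → ℤ) → NSym K
  | 0, _, _ => 1
  | k + 1, a, c => ∑ i : Fin (k + 1), (-1 : K) ^ (i : ℕ) •
      (H K (a 0 + c i) * rowDet k (fun r => a r.succ) (fun s => c (i.succAbove s)))

theorem rowDet_succ (k : ℕ) (a c : Fin (k + 1) → ℤ) :
    rowDet K (k + 1) a c = ∑ i : Fin (k + 1), (-1 : K) ^ (i : ℕ) •
      (H K (a 0 + c i) * rowDet K k (fun r => a r.succ) (fun s => c (i.succAbove s))) := rfl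

theorem rowDet_sub_const (k : ℕ) (a c : Fin k → ℤ) (t : ℤ) :
    rowDet K k (fun r => a r - t) c = rowDet K k a (fun s => c s - t) := by
  induction k with
  | zero => rfl
  | succ k ih =>
    simp only [rowDet_succ]
    refine Finset.sum_congr rfl fun i _ => ?_
    rw [ih, show a 0 - t + c i = a 0 + (c i - t) by ring]

/-- The determinant vanishes if two adjacent columns are equal. -/
theorem rowDet_eq_zero (k : ℕ) (a c : Fin k → ℤ) (j : ℕ) (hj : j + 1 < k)
    (h : c ⟨j, by omega⟩ = c ⟨j + 1, hj⟩) : rowDet K k a c = 0 := by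
  induction k generalizing j with
  | zero => omega
  | succ k ih =>
    -- In the expansion along the first row, dropping column `j` or column `j + 1` leaves the same
    -- minor and the same first factor with opposite signs. Every other minor still contains both
    -- equal columns, still adjacent, and vanishes by induction.
    rw [rowDet_succ, ← Finset.add_sum_erase _ _ (Finset.mem_univ (⟨j, by omega⟩ : Fin (k + 1))),
      ← Finset.add_sum_erase _ _ (show (⟨j + 1, hj⟩ : Fin (k + 1)) ∈ _ by simp), ← add_assoc,
      Finset.sum_eq_zero, add_zero]
    · have hc : (fun s => c ((⟨j, by omega⟩ : Fin (k + 1)).succAbove s)) =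
          fun s => c ((⟨j + 1, hj⟩ : Fin (k + 1)).succAbove s) := by
        funext s
        by_cases hs : (s : ℕ) = j
        · have h1 : (⟨j, by omega⟩ : Fin (k + 1)).succAbove s = ⟨j + 1, hj⟩ := by
            ext; simp [Fin.succAbove, Fin.lt_def, hs]
          have h2 : (⟨j + 1, hj⟩ : Fin (k + 1)).succAbove s = ⟨j, by omega⟩ := by
            ext; simp [Fin.succAbove, Fin.lt_def, hs]
          rw [h1, h2, h]
        · congr 1
          ext
          simp only [Fin.succAbove, Fin.lt_def, Fin.val_castSucc]
          split_ifs <;> first | rfl | omega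
      rw [hc, h, pow_succ, mul_neg_one, neg_smul, add_neg_cancel]
    · intro i hi
      simp only [Finset.mem_erase, Finset.mem_univ, and_true, ne_eq, Fin.ext_iff] at hi
      have hik := i.isLt
      suffices hz : rowDet K k (fun r => a r.succ) (fun s => c (i.succAbove s)) = 0 by
        rw [hz, mul_zero, smul_zero]
      rcases lt_or_gt_of_ne hi.2 with hlt | hgt
      -- Dropping a column to the left moves the equal pair one place down; dropping one to the
      -- right leaves its position alone.
      · refine ih _ _ (j - 1) (by omega) ?_
        have h1 : i.succAbove ⟨j - 1, by omega⟩ = ⟨j, by omega⟩ := by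
          ext; simp only [Fin.succAbove, Fin.lt_def, Fin.val_castSucc]
          split_ifs <;> simp <;> omega
        have h2 : i.succAbove ⟨j - 1 + 1, by omega⟩ = ⟨j + 1, hj⟩ := by
          ext; simp only [Fin.succAbove, Fin.lt_def, Fin.val_castSucc]
          split_ifs <;> simp <;> omega
        rw [h1, h2, h]
      · refine ih _ _ j (by omega) ?_
        have h1 : i.succAbove ⟨j, by omega⟩ = ⟨j, by omega⟩ := by
          ext; simp only [Fin.succAbove, Fin.lt_def, Fin.val_castSucc]
          split_ifs <;> simp
        have h2 : i.succAbove ⟨j + 1, by omega⟩ = ⟨j + 1, hj⟩ := by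
          ext; simp only [Fin.succAbove, Fin.lt_def, Fin.val_castSucc]
          split_ifs; simp; omega
        rw [h1, h2, h]

/-- `F_{1^j}^⊥` lowers `j` columns of the determinant in all possible ways. -/
theorem onesPerp_rowDet (k j : ℕ) (a c : Fin k → ℤ) :
    onesPerp K j (rowDet K k a c) = ∑ e : Fin k → Fin 2,
      if ∑ s, (e s : ℕ) = j then rowDet K k a (fun s => c s - (e s : ℕ)) else 0 := by
  induction k generalizing j with
  | zero =>
    rw [rowDet, onesPerp_one, Fintype.sum_unique]
    simp [rowDet, eq_comm]
  | succ k ih =>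
    simp only [rowDet_succ, map_sum, map_smul, ← Finset.sum_filter]
    rw [Finset.sum_comm]
    refine Finset.sum_congr rfl fun i _ => ?_
    rw [← Finset.smul_sum]
    congr 1
    -- The choice for column `i`, which meets the first row, is separated from the choices for the
    -- minor: they are the two terms of the product rule.
    rw [Finset.sum_filter, ← (Fin.insertNthEquiv (fun _ => Fin 2) i).sum_comp,
      Fintype.sum_prod_type, Fin.sum_univ_two]
    simp only [Fin.insertNthEquiv_apply, Fin.sum_univ_succAbove _ i, Fin.insertNth_apply_same,
      Fin.insertNth_apply_succAbove, Fin.val_zero, Fin.val_one, Nat.cast_zero, Nat.cast_one,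
      zero_add, sub_zero]
    cases j with
    | zero =>
      -- For `j = 0` there is no lowered term; the choices that lower column `i` have positive sum
      -- and contribute nothing. The operator `onesPerp K 0` is put back so that the induction
      -- hypothesis applies.
      rw [onesPerp_zero, ← onesPerp_zero (rowDet K k _ _), ih, Finset.mul_sum]
      simp only [mul_ite, mul_zero]
      rw [left_eq_add]
      exact Finset.sum_eq_zero fun e _ => if_neg (by omega)
    | succ j =>
      rw [onesPerp_H_mul, ih, ih, Finset.mul_sum, Finset.mul_sum, add_sub_assoc]
      simp only [mul_ite, mul_zero]
      congr 1
      refine Finset.sum_congr rfl fun e _ => ?_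
      exact if_congr (by omega) rfl rfl

/-- A sequence that never rises from `0` to `1` consists of ones followed by zeros, so its sum
determines it. A zero at `s` bounds the sum by `s`, and a one at `s` forces at least `s + 1` ones.
-/
theorem eq_initial_of_antitone {k : ℕ} (e : Fin k → Fin 2)
    (h : ∀ j (hj : j + 1 < k), e ⟨j, by omega⟩ = 0 → e ⟨j + 1, hj⟩ = 0) (s : Fin k) :
    e s = if (s : ℕ) < ∑ s, (e s : ℕ) then 1 else 0 := by
  have hup : ∀ d j (hj : j + d < k), e ⟨j, by omega⟩ = 0 → e ⟨j + d, hj⟩ = 0 := by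
    intro d
    induction d with
    | zero => exact fun j _ h0 => h0
    | succ d ih => exact fun j hj h0 => h (j + d) hj (ih j (by omega) h0)
  have hmono : ∀ u v : Fin k, u ≤ v → e u = 0 → e v = 0 := by
    intro u v huv h0
    have := hup (v - u) u (by have := v.isLt; rw [Fin.le_def] at huv; omega) h0
    rw [Fin.le_def] at huv
    simpa [Nat.add_sub_of_le huv] using this
  have hcases : ∀ t, e t = 0 ∨ e t = 1 := fun t => by
    rcases Fin.exists_fin_two.1 ⟨e t, rfl⟩ with h | h <;> simp [h]
  rcases hcases s with h0 | h1
  · rw [h0, if_neg]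
    rw [not_lt]
    calc ∑ t, (e t : ℕ) ≤ ∑ t, if t < s then 1 else 0 := by
          refine Finset.sum_le_sum fun t _ => ?_
          split_ifs with hts
          · omega
          · rw [hmono s t (not_lt.1 hts) h0]; rfl
      _ = s := by
          rw [Finset.sum_boole, Finset.filter_gt_eq_Iio, Fin.card_Iio, Nat.cast_id]
  · rw [h1, if_pos]
    calc (s : ℕ) < ∑ t, if t ≤ s then 1 else 0 := by
          rw [Finset.sum_boole, Finset.filter_ge_eq_Iic, Fin.card_Iic, Nat.cast_id]
          exact Nat.lt_succ_self _
      _ ≤ ∑ t, (e t : ℕ) := by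
          refine Finset.sum_le_sum fun t _ => ?_
          split_ifs with hts
          · rcases hcases t with h0 | h0
            · rw [hmono t s hts h0] at h1
              exact absurd h1 (by decide)
            · rw [h0]; rfl
          · omega

/-- If column `l + 1` is lowered and column `l` is not, both get the label `l` and the determinant
vanishes. So only the choice of the first `j` columns survives, and none if there are fewer than
`j`. -/
theorem onesPerp_rowDet_consecutive (k j : ℕ) (a : Fin k → ℤ) :
    onesPerp K j (rowDet K k a fun s => ((s : ℕ) : ℤ)) =
      if j ≤ k then rowDet K k a (fun s => if (s : ℕ) < j then ((s : ℕ) : ℤ) - 1 else (s : ℕ))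
      else 0 := by
  rw [onesPerp_rowDet, ← Finset.sum_filter]
  have hsum : j ≤ k → ∑ s : Fin k, (((if (s : ℕ) < j then 1 else 0 : Fin 2)) : ℕ) = j := by
    intro hj
    have h1 : ∀ s : Fin k, (((if (s : ℕ) < j then 1 else 0 : Fin 2)) : ℕ) =
        if (s : ℕ) < j then 1 else 0 := fun s => by split_ifs <;> rfl
    simp only [h1]
    rw [Finset.sum_boole, Fin.card_filter_val_lt]
    simpa using hj
  have hzero : ∀ e : Fin k → Fin 2, ∑ s, (e s : ℕ) = j →
      (e ≠ fun s : Fin k => if (s : ℕ) < j then 1 else 0) →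
        rowDet K k a (fun s => ((s : ℕ) : ℤ) - (e s : ℕ)) = 0 := by
    intro e he hne
    by_contra hD
    refine hne (funext fun s => ?_)
    rw [← he]
    refine eq_initial_of_antitone e (fun l hl h0 => ?_) s
    by_contra h1
    have h2 : e ⟨l + 1, hl⟩ = 1 := by omega
    refine hD (rowDet_eq_zero k a _ l hl ?_)
    rw [h0, h2]
    simp
  split_ifs with hj
  · rw [Finset.sum_eq_single fun s : Fin k => if (s : ℕ) < j then 1 else 0]
    · congr 1
      funext s
      by_cases hs : (s : ℕ) < j <;> simp [hs]
    · intro e he hne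
      exact hzero e (Finset.mem_filter.1 he).2 hne
    · intro h
      exact absurd (by rw [Finset.mem_filter]; exact ⟨Finset.mem_univ _, hsum hj⟩) h
  · refine Finset.sum_eq_zero fun e he => ?_
    have h1 : ∑ s, (e s : ℕ) ≤ ∑ _s : Fin k, 1 := Finset.sum_le_sum fun s _ => by omega
    rw [(Finset.mem_filter.1 he).2] at h1
    simp at h1
    omega

/-- The Jacobi–Trudi identity for immaculate functions. -/
theorem immaculate_eq_rowDet (k : ℕ) (μ : Fin k → ℤ) :
    immaculate K (List.ofFn μ) =
      rowDet K k (fun r => μ r - (r : ℕ)) fun s => ((s : ℕ) : ℤ) := by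
  induction k with
  | zero => simp [immaculate, rowDet]
  | succ k ih =>
    rw [List.ofFn_succ]
    change bernstein K (μ 0) (immaculate K (List.ofFn fun r => μ r.succ)) = _
    rw [ih]
    set x := rowDet K k (fun r => μ r.succ - (r : ℕ)) fun s => ((s : ℕ) : ℤ) with hx
    obtain ⟨N₀, hN₀⟩ := exists_bernstein_eq_sum (μ 0) x
    -- The first `k + 1` terms match the columns of the larger determinant; the remaining `N₀` terms
    -- lower more than `k` columns and vanish.
    rw [hN₀ (k + 1 + N₀) (by omega), rowDet_succ, Finset.sum_range_add,
      Finset.sum_eq_zero (s := Finset.range N₀), add_zero, ← Fin.sum_univ_eq_sum_range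
        fun i => (-1 : K) ^ i • (H K (μ 0 + i) * onesPerp K i x)]
    · refine Finset.sum_congr rfl fun i _ => ?_
      rw [hx, onesPerp_rowDet_consecutive, if_pos (by omega)]
      simp only [Fin.val_zero, Nat.cast_zero, sub_zero, Fin.val_succ]
      -- The minor without column `i` has the labels `0, …, i-1, i+1, …, k`. Moving the row shift by
      -- one into the columns gives `-1, …, i-2, i, …, k-1`, which are the columns produced by
      -- `F_{1^i}^⊥`.
      have h1 : (fun r : Fin k => μ r.succ - ((r + 1 : ℕ) : ℤ)) =
          fun r : Fin k => (μ r.succ - (r : ℕ)) - 1 := by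
        funext r
        push_cast
        ring
      rw [h1, rowDet_sub_const]
      congr 3
      funext s
      simp only [Fin.succAbove, Fin.lt_def, Fin.val_castSucc]
      split_ifs <;> simp
    · intro i _
      rw [hx, onesPerp_rowDet_consecutive, if_neg (by omega), mul_zero, smul_zero]

end RowDeterminant

/-! ### Complete expansion of the determinant by successive column deletions -/

section Deletions

variable {K : Type*} [CommRing K]

/-- The sequence `c` with its entry number `i` deleted. -/
def deleteAt (i : ℕ) (c : ℕ → ℤ) : ℕ → ℤ := fun s => if s < i then c s else c (s + 1)

/-- The sequence that remains of `c` after the first `n` of the deletions `d 0, d 1, …`. -/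
def remaining {k : ℕ} (d : Fin k → ℕ) (c : ℕ → ℤ) : ℕ → ℕ → ℤ
  | 0 => c
  | n + 1 => if h : n < k then deleteAt (d ⟨n, h⟩) (remaining d c n) else remaining d c n

/-- `remaining` adds deletions at the end, whereas the row expansion strips them from the front;
this reconciles the two recursions. -/
theorem remaining_cons {k : ℕ} (i : ℕ) (d : Fin k → ℕ) (c : ℕ → ℤ) (n : ℕ) :
    remaining (Fin.cons i d : Fin (k + 1) → ℕ) c (n + 1) = remaining d (deleteAt i c) n := by
  induction n with
  | zero => simp only [remaining, Nat.succ_pos, dite_true]; rfl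
  | succ n ih =>
    rw [remaining, ih, remaining]
    simp only [Nat.add_lt_add_iff_right]
    rfl

/-- A term is recorded by the Lehmer code `d` of its permutation: row `r` takes entry number `d r`
among the `k - r` columns not yet used, with the cofactor sign `(-1)^{d r}`. -/
theorem rowDet_eq_sum_deletions (k : ℕ) (a : Fin k → ℤ) (c : ℕ → ℤ) :
    rowDet K k a (fun s => c s) =
      ∑ d ∈ Fintype.piFinset fun r : Fin k => Finset.range (k - r), (∏ r, (-1 : K) ^ d r) •
        HSeq K (List.ofFn fun r => a r + remaining d c r (d r)) := by
  induction k generalizing c with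
  | zero => simp [rowDet, HSeq]
  | succ k ih =>
    rw [rowDet_succ]
    have hdel : ∀ i : Fin (k + 1), (fun s : Fin k => c (i.succAbove s)) =
        fun s : Fin k => deleteAt i c s := by
      intro i
      funext s
      simp only [deleteAt, Fin.succAbove, Fin.lt_def, Fin.val_castSucc]
      split_ifs <;> rfl
    simp only [hdel, ih, Finset.mul_sum, Finset.smul_sum]
    rw [Fin.sum_univ_eq_sum_range (fun i => ∑ d ∈ Fintype.piFinset fun r : Fin k =>
        Finset.range (k - r), (-1 : K) ^ i • (H K (a 0 + c i) * (∏ r, (-1 : K) ^ d r) •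
          HSeq K (List.ofFn fun r => a r.succ + remaining d (deleteAt i c) r (d r)))),
      ← Finset.sum_product']
    refine Finset.sum_bij (fun x _ => (Fin.cons x.1 x.2 : Fin (k + 1) → ℕ)) ?_ ?_ ?_ ?_
    · rintro ⟨i, d⟩ h
      simp only [Finset.mem_product, Finset.mem_range, Fintype.mem_piFinset] at h ⊢
      refine Fin.cases (by simpa using h.1) fun r => ?_
      have := h.2 r
      simp only [Fin.cons_succ, Fin.val_succ]
      omega
    · rintro ⟨i, d⟩ _ ⟨i', d'⟩ _ h
      obtain ⟨h1, h2⟩ := Fin.cons_injective2 h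
      exact Prod.ext h1 h2
    · intro d h
      rw [Fintype.mem_piFinset] at h
      refine ⟨(d 0, fun r => d r.succ), ?_, Fin.cons_self_tail d⟩
      simp only [Finset.mem_product, Finset.mem_range, Fintype.mem_piFinset]
      refine ⟨by simpa using h 0, fun r => ?_⟩
      have := h r.succ
      rw [Finset.mem_range, Fin.val_succ] at this
      omega
    · rintro ⟨i, d⟩ _
      rw [Fin.prod_univ_succ, List.ofFn_succ]
      simp only [Fin.cons_zero, Fin.cons_succ, Fin.val_zero, Fin.val_succ, remaining_cons]
      rw [mul_smul_comm, smul_smul]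
      rfl

end Deletions

/-! ### Tunnel hook coverings as sequences of deletions -/

section Coverings

variable {k : ℕ}

/-- The three colouring cases all encode the same signed difference, so they play no further role in
hook values. -/
theorem blueCount_sub_redCount (μ : Fin k → ℤ) (ν : Fin k → ℕ) (r : Fin k) :
    (blueCount μ ν r : ℤ) - redCount μ ν r = μ r - ν r := by
  rw [blueCount, redCount]
  split_ifs <;> omega

theorem mem_boundaryCells {μ : Fin k → ℤ} {ν : Fin k → ℕ} {r : Fin k} {c : Fin k × ℕ} :
    c ∈ boundaryCells μ ν r ↔ c.2 ∈ boundaryColumns μ ν r c.1 := by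
  rw [boundaryCells, Finset.mem_biUnion]
  constructor
  · rintro ⟨p, -, h⟩
    obtain ⟨q, hq, rfl⟩ := Finset.mem_image.1 h
    exact hq
  · exact fun h => ⟨c.1, Finset.mem_univ _, Finset.mem_image.2 ⟨c.2, h, rfl⟩⟩

theorem card_tunnelHook_row (μ : Fin k → ℤ) (ν : Fin k → ℕ) (r : Fin k) (τ : Fin k × ℕ)
    (i : Fin k) (hi : r ≤ i) : ((tunnelHook μ ν r τ).filter fun c => c.1 = i).card =
      if i ≤ τ.1 then (boundaryColumns μ ν r i).card else 0 := by
  split_ifs with h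
  · rw [← Finset.card_image_of_injective (boundaryColumns μ ν r i)
      (f := fun q => (i, q)) fun _ _ h => (Prod.mk.inj h).2]
    congr 1
    ext ⟨p, q⟩
    simp only [tunnelHook, Finset.mem_filter, mem_boundaryCells, Finset.mem_image, Prod.mk.injEq]
    constructor
    · rintro ⟨⟨h1, -⟩, rfl⟩
      exact ⟨q, h1, rfl, rfl⟩
    · rintro ⟨_, h1, rfl, rfl⟩
      exact ⟨⟨h1, hi, h⟩, rfl⟩
  · rw [Finset.card_eq_zero, Finset.filter_eq_empty_iff]
    rintro c hc rfl
    exact h (Finset.mem_filter.1 hc).2.2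

/-- The inner shape above the row `s` in terms of the deletions: the numbers `p - ν_p` with `p ≥ s`
are what remains of `0, 1, 2, …`. -/
theorem innerShape_spec (μ : Fin k → ℤ) (γ : Fin k → Fin k × ℕ) (hγ : ∀ r, r ≤ (γ r).1) (s : ℕ) :
    (∀ p : Fin k, s ≤ p → ((p : ℕ) : ℤ) - innerShape μ γ s p =
      remaining (fun r => ((γ r).1 : ℕ) - r) (fun j => (j : ℤ)) s (p - s)) ∧
    ∀ p q : Fin k, s ≤ p → p ≤ q → innerShape μ γ s q ≤ innerShape μ γ s p := by
  induction s with
  | zero => exact ⟨fun p _ => by simp [innerShape, remaining], fun p q _ _ => by simp [innerShape]⟩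
  | succ s ih =>
    obtain ⟨ih1, ih2⟩ := ih
    -- A hook that reaches row `p` fills it up to column `ν_{p-1} + 1`, so `p - ν_p` becomes the old
    -- number of row `p - 1`; rows beyond the terminal one keep theirs. In effect the number of the
    -- terminal row is deleted. Antitonicity of the inner shape makes the natural subtraction in the
    -- cell count exact.
    have hstep : ∀ p : Fin k, (hp : s + 1 ≤ p) → innerShape μ γ (s + 1) p =
        if p ≤ (γ ⟨s, by omega⟩).1 then innerShape μ γ s ⟨p - 1, by omega⟩ + 1
        else innerShape μ γ s p := by
      intro p hp
      have hs : s < k := by omega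
      have hle := ih2 ⟨p - 1, by omega⟩ p (by simp only; omega)
        (by rw [Fin.le_def]; simp only; omega)
      have hlt : (⟨s, hs⟩ : Fin k) < p := Fin.lt_def.2 hp
      have hne : p ≠ ⟨s, hs⟩ := hlt.ne'
      simp only [innerShape]
      rw [dif_pos hs, card_tunnelHook_row _ _ _ _ _ (by rw [Fin.le_def]; simp only; omega),
        boundaryColumns, if_neg hne, if_pos hlt, Nat.card_Icc]
      split_ifs <;> omega
    constructor
    · intro p hp
      have hs : s < k := by omega
      have hg := hγ ⟨s, hs⟩
      rw [Fin.le_def] at hg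
      rw [hstep p hp, remaining, dif_pos hs, deleteAt]
      simp only at hg ⊢
      by_cases h : p ≤ (γ ⟨s, hs⟩).1
      · have h1 := ih1 ⟨p - 1, by omega⟩ (by simp only; omega)
        rw [if_pos h, if_pos (by rw [Fin.le_def] at h; omega)]
        simp only at h1
        rw [show (p : ℕ) - (s + 1) = p - 1 - s by omega, ← h1]
        omega
      · have h1 := ih1 p (by omega)
        rw [if_neg h, if_neg (by rw [Fin.le_def] at h; omega), h1]
        congr 1
        omega
    · intro p q hp hpq
      rw [hstep p hp, hstep q (hp.trans hpq)]
      have hpq' := Fin.le_def.1 hpq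
      split_ifs with h1 h2 h2
      · exact Nat.succ_le_succ (ih2 _ _ (by simp only; omega) (by rw [Fin.le_def]; simp only; omega))
      · exact absurd (hpq.trans h1) h2
      · exact (ih2 _ _ (by simp only; omega) (by rw [Fin.le_def]; simp only; omega)).trans
          (Nat.le_succ _)
      · exact ih2 p q (by omega) hpq

theorem IsTunnelHookCovering.le {μ : Fin k → ℤ} {γ : Fin k → Fin k × ℕ}
    (hγ : IsTunnelHookCovering μ γ) (r : Fin k) : r ≤ (γ r).1 := by
  have h := mem_boundaryCells.1 (Finset.mem_filter.1 (hγ r)).1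
  rw [boundaryColumns] at h
  split_ifs at h with h1 h2
  · exact h1.ge
  · exact h2.le
  · exact absurd h (Finset.notMem_empty _)

/-- The inner shape is weakly decreasing from row `r` on, so every row `p ≥ r` has a boundary cell
in column `ν_p + 1`. The terminal row is therefore a free choice and fixes the terminal column. -/
theorem isTunnelHookCovering_iff {μ : Fin k → ℤ} {γ : Fin k → Fin k × ℕ} :
    IsTunnelHookCovering μ γ ↔
      (∀ r, r ≤ (γ r).1) ∧ ∀ r, (γ r).2 = innerShape μ γ r (γ r).1 + 1 := by
  refine ⟨fun h => ⟨h.le, fun r => (Finset.mem_filter.1 (h r)).2⟩, fun h r => ?_⟩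
  refine Finset.mem_filter.2 ⟨mem_boundaryCells.2 ?_, h.2 r⟩
  rw [h.2 r, boundaryColumns]
  have hle := Fin.le_def.1 (h.1 r)
  split_ifs with h1 h2
  · rw [h1]
    exact Finset.mem_Icc.2 ⟨le_rfl, le_max_left _ _⟩
  · have h3 := Fin.lt_def.1 h2
    refine Finset.mem_Icc.2 ⟨le_rfl, Nat.succ_le_succ ?_⟩
    exact (innerShape_spec μ γ h.1 r).2 _ _ (by simp only; omega)
      (by rw [Fin.le_def]; simp only; omega)
  · exact absurd (lt_of_le_of_ne (h.1 r) (Ne.symm h1)) h2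

/-- With `q = ν_p + 1` the contributions of `ν_r` cancel, and the value is `μ_r - r + (p - ν_p)`. -/
theorem IsTunnelHookCovering.hookValue_eq {μ : Fin k → ℤ} {γ : Fin k → Fin k × ℕ}
    (hγ : IsTunnelHookCovering μ γ) (r : Fin k) :
    hookValue μ (innerShape μ γ r) r (γ r) = μ r - (r : ℕ) +
      remaining (fun r => ((γ r).1 : ℕ) - r) (fun j => (j : ℤ)) r ((γ r).1 - r) := by
  rw [← (innerShape_spec μ γ hγ.le r).1 (γ r).1 (hγ.le r), hookValue, blueCount_sub_redCount,
    (isTunnelHookCovering_iff.1 hγ).2 r]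
  push_cast
  ring

/-- The bijection sends a covering to the heights `p - r` of its hooks. An arbitrary `f` carries
values and signs across together. -/
theorem sum_tunnelHookCoverings {M : Type*} [AddCommMonoid M] (μ : Fin k → ℤ)
    (f : List ℤ → ℤ → M) :
    ∑ γ ∈ tunnelHookCoverings μ, f (coveringValue μ γ) (coveringSign γ) =
      ∑ d ∈ Fintype.piFinset fun r : Fin k => Finset.range (k - r),
        f (List.ofFn fun r => μ r - (r : ℕ) + remaining d (fun j => (j : ℤ)) r (d r))
          (∏ r, (-1) ^ d r) := by
  refine Finset.sum_bij (fun γ _ r => ((γ r).1 : ℕ) - r) ?_ ?_ ?_ ?_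
  · intro γ hγ
    rw [mem_tunnelHookCoverings] at hγ
    rw [Fintype.mem_piFinset]
    intro r
    have := hγ.le r
    rw [Fin.le_def] at this
    rw [Finset.mem_range]
    omega
  · intro γ hγ δ hδ h
    rw [mem_tunnelHookCoverings] at hγ hδ
    refine isTunnelHookCovering_ext hγ hδ fun r => ?_
    have h0 := congrFun h r
    have h1 := Fin.le_def.1 (hγ.le r)
    have h2 := Fin.le_def.1 (hδ.le r)
    rw [Fin.ext_iff]
    omega
  · intro d hd
    have hlt : ∀ r : Fin k, r + d r < k := fun r => by
      have := Finset.mem_range.1 (Fintype.mem_piFinset.1 hd r)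
      omega
    let row : Fin k → Fin k := fun r => ⟨r + d r, hlt r⟩
    have hrow : ∀ r, r ≤ row r := fun r => Fin.le_def.2 (Nat.le_add_right _ _)
    have hinner : ∀ (γ δ : Fin k → Fin k × ℕ), (∀ r, (γ r).1 = (δ r).1) → ∀ s,
        innerShape μ γ s = innerShape μ δ s := by
      intro γ δ h s
      induction s with
      | zero => rfl
      | succ s ih =>
        funext i
        simp only [innerShape, ih, tunnelHook, h]
    -- Inner shapes depend only on the terminal rows, so they can be computed with the dummy column
    -- `0` before the true terminal columns are known.
    let γ : Fin k → Fin k × ℕ :=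
      fun r => (row r, innerShape μ (fun r => (row r, 0)) r (row r) + 1)
    refine ⟨γ, mem_tunnelHookCoverings.2 (isTunnelHookCovering_iff.2 ⟨hrow, fun r => ?_⟩), ?_⟩
    · rw [hinner γ (fun r => (row r, 0)) fun _ => rfl]
    · funext r
      exact Nat.add_sub_cancel_left _ _
  · intro γ hγ
    rw [mem_tunnelHookCoverings] at hγ
    simp only [coveringValue, hγ.hookValue_eq]
    rfl

end Coverings

/-! ### Coefficients of the immaculates and expansion in the dual basis -/

section Expansion

variable {K : Type*} [CommRing K]

/-- The expansion of an immaculate function into the `H_α`, indexed by tunnel hook coverings. -/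
theorem immaculate_eq_sum_tunnelHookCoverings {k : ℕ} (μ : Fin k → ℤ) :
    immaculate K (List.ofFn μ) =
      ∑ γ ∈ tunnelHookCoverings μ, (coveringSign γ : K) • HSeq K (coveringValue μ γ) := by
  rw [sum_tunnelHookCoverings μ fun l e => (e : K) • HSeq K l, immaculate_eq_rowDet,
    rowDet_eq_sum_deletions k _ fun j => (j : ℤ)]
  simp only [Int.cast_prod, Int.cast_pow, Int.cast_neg, Int.cast_one]

theorem HSeq_flatten (l : List ℤ) : HSeq K (flatten l) = HSeq K l := by
  induction l with
  | nil => rfl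
  | cons a l ih =>
    by_cases h : a = 0
    · have h1 : flatten (a :: l) = flatten l := by simp [flatten, h]
      rw [h1, ih, h, HSeq, HSeq, List.map_cons, List.prod_cons, H_zero, one_mul]
    · have h1 : flatten (a :: l) = a :: flatten l := by simp [flatten, h]
      simp only [HSeq] at ih
      rw [h1, HSeq, HSeq, List.map_cons, List.map_cons, List.prod_cons, List.prod_cons, ih]

theorem pairing_HSeq_monomial (l : List ℤ) {n : ℕ} (α : Composition n) :
    pairing K (HSeq K l) (monomialQSym K α) = if flatten l = seq α then 1 else 0 := by
  rw [← HSeq_flatten]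
  by_cases hl : ∀ a ∈ flatten l, 0 < a
  · obtain ⟨w, hw⟩ := exists_word ((flatten l).map Int.toNat) (by
      intro b hb
      obtain ⟨a, ha, rfl⟩ := List.mem_map.1 hb
      have := hl a ha
      omega)
    have hcast : flatten l = (parts w).map (Nat.cast : ℕ → ℤ) := by
      rw [hw, List.map_map]
      conv_lhs => rw [← List.map_id (flatten l)]
      refine List.map_congr_left fun a ha => ?_
      have := hl a ha
      simp only [id, Function.comp_apply]
      omega
    rw [hcast, ← wordBasis_eq_HSeq, pairing_wordBasis_monomial, seq]
    exact if_congr (List.map_injective_iff.2 Nat.cast_injective).eq_iff.symm rfl rfl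
  · push Not at hl
    obtain ⟨a, ha, h0⟩ := hl
    have hne : a ≠ 0 := by simpa using (List.mem_filter.1 ha).2
    -- A negative entry annihilates the product. As `flatten` keeps negative entries, such a
    -- sequence cannot equal a composition either, so both sides are `0`.
    have hz : HSeq K (flatten l) = 0 := by
      obtain ⟨u, v, huv⟩ := List.append_of_mem ha
      rw [huv, HSeq, List.map_append, List.map_cons, List.prod_append, List.prod_cons,
        H_of_neg (lt_of_le_of_ne h0 hne), zero_mul, mul_zero]
    rw [hz, map_zero, LinearMap.zero_apply, if_neg]
    intro h
    rw [h, seq] at ha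
    obtain ⟨b, -, rfl⟩ := List.mem_map.1 ha
    have : (0 : ℤ) ≤ (b : ℤ) := Int.natCast_nonneg b
    omega

theorem ofFn_shape {n : ℕ} (μ : Composition n) : List.ofFn (shape μ) = seq μ := by
  rw [seq, ← μ.ofFn_blocksFun, List.map_ofFn]
  rfl

theorem pairing_immaculate_monomial {m n : ℕ} (μ : Composition m) (α : Composition n) :
    pairing K (immaculate K (seq μ)) (monomialQSym K α) =
      ∑ γ ∈ tunnelHookCoverings (shape μ) with flatten (coveringValue (shape μ) γ) = seq α,
        (coveringSign γ : K) := by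
  rw [← ofFn_shape, immaculate_eq_sum_tunnelHookCoverings, map_sum, LinearMap.sum_apply,
    Finset.sum_filter]
  refine Finset.sum_congr rfl fun γ _ => ?_
  rw [map_smul, LinearMap.smul_apply, pairing_HSeq_monomial, smul_eq_mul, mul_ite, mul_one,
    mul_zero]

theorem pairing_immaculate_monomial_eq_zero {m n : ℕ} (μ : Composition m) (α : Composition n)
    (hmn : m ≠ n) : pairing K (immaculate K (seq μ)) (monomialQSym K α) = 0 := by
  suffices h : wordSpan K (fun l => l.sum = m) ≤
      LinearMap.ker ((pairing K).flip (monomialQSym K α)) from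
    LinearMap.mem_ker.1 (h (immaculate_mem μ))
  refine wordSpan_le fun w hw => ?_
  rw [LinearMap.mem_ker, LinearMap.flip_apply, pairing_wordBasis_monomial, if_neg]
  intro he
  exact hmn (by rw [← hw, he, α.blocks_sum])

/-- Adding `g` to a dual immaculate function preserves the property that determines it uniquely; the
empty composition is an arbitrary choice. -/
theorem eq_zero_of_pairing_immaculate {g : QSym K}
    (h : ∀ (m : ℕ) (μ : Composition m), pairing K (immaculate K (seq μ)) g = 0) : g = 0 := by
  have h1 := (existsUnique_dual K (Composition.ones 0)).unique
    (y₁ := dualImmaculate K (Composition.ones 0) + g)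
    (y₂ := dualImmaculate K (Composition.ones 0))
    (fun m μ => by rw [map_add, h, add_zero, pairing_immaculate_dualImmaculate])
    (fun m μ => pairing_immaculate_dualImmaculate K μ _)
  simpa using h1

theorem monomialQSym_eq_sum_dualImmaculate {n : ℕ} (α : Composition n) :
    monomialQSym K α = ∑ μ : Composition n,
      pairing K (immaculate K (seq μ)) (monomialQSym K α) • dualImmaculate K μ := by
  rw [← sub_eq_zero]
  refine eq_zero_of_pairing_immaculate fun m μ => ?_
  simp only [map_sub, map_sum, map_smul, smul_eq_mul, pairing_immaculate_dualImmaculate]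
  -- In degree `n` duality picks out the single term of `μ`; in any other degree both sides pair to
  -- zero with `𝔖_μ`.
  by_cases hmn : m = n
  · subst hmn
    rw [Finset.sum_eq_single μ, if_pos rfl, mul_one, sub_self]
    · intro β _ hβ
      rw [if_neg fun h => hβ (Composition.ext h.symm), mul_zero]
    · exact fun h => absurd (Finset.mem_univ _) h
  · rw [pairing_immaculate_monomial_eq_zero μ α hmn, zero_sub, neg_eq_zero]
    refine Finset.sum_eq_zero fun β _ => ?_
    rw [if_neg, mul_zero]
    intro h
    exact hmn (by rw [← μ.blocks_sum, h, β.blocks_sum])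

end Expansion

end QSymNSym

end

theorem mainTheorem6 (K : Type*) [Field K] [CharZero K] {n : ℕ} (α : Composition n) :
    QSymNSym.monomialQSym K α =
      ∑ μ : Composition n,
        ∑ γ ∈ QSymNSym.tunnelHookCoverings (QSymNSym.shape μ) with
            QSymNSym.flatten (QSymNSym.coveringValue (QSymNSym.shape μ) γ) = QSymNSym.seq α,
          ((QSymNSym.coveringSign γ : ℤ) : K) • QSymNSym.dualImmaculate K μ := by
  conv_lhs => rw [QSymNSym.monomialQSym_eq_sum_dualImmaculate α]
  refine Finset.sum_congr rfl fun μ _ => ?_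
  rw [QSymNSym.pairing_immaculate_monomial, Finset.sum_smul]
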